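/- Let $N$ and $L$ be positive integers. An $(N,L)$-partition is a partition $\lambda$ of length at most $N$ with $\lambda_1-\lambda_N\le L$. An $(N,L)$-horizontal strip is a pair of partitions $\lambda/\mu$ with $\lambda_1\ge\mu_1\ge\lambda_2\ge\mu_2\ge\cdots$, $\ell(\lambda)\le N$ and $\lambda_1-\mu_N\le L$; its size is $|\lambda|-|\mu|$. For partitions $\lambda,\mu$ and a vector $\alpha=(\alpha_1,\dots,\alpha_r)$ of nonnegative integers, let $K^{\mathrm{cyl}}_{\lambda/\mu,\alpha}$ be the number of $(N,L)$-cylindric semistandard tableaux of shape $\lambda/\mu$ and weight $\alpha$, that is, of sequences of partitions $\mu=\nu^{(0)},\nu^{(1)},\dots,\nu^{(r)}=\lambda$ such that $\nu^{(i)}/\nu^{(i-1)}$ is an $(N,L)$-horizontal strip of size $\alpha_i$ for each $i$; for a partition $\alpha$ the weight is the vector of its nonzero parts. Write $K^{\mathrm{cyl}}_{\lambda,\alpha}=K^{\mathrm{cyl}}_{\lambda/\emptyset,\alpha}$. Let $\Lambda^{(N,L)}$ be the fusion ring, the quotient of the ring of symmetric polynomials in $N$ variables over $\mathbb{Z}$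 by the ideal generated by the Schur polynomials $s_\lambda$ with $\lambda_1-\lambda_N=L+1$, and let $S_\lambda$ be the image of $s_\lambda$ in $\Lambda^{(N,L)}$. Then the elements $S_\lambda$, for $\lambda$ an $(N,L)$-partition, form a $\mathbb{Z}$-basis of $\Lambda^{(N,L)}$. Let the fusion coefficients $d^\lambda_{\mu\nu}\in\mathbb{Z}$ be the structure constants of this basis, so that $S_\mu S_\nu=\sum_\lambda d^\lambda_{\mu\nu}S_\lambda$. For any $(N,L)$-partitions $\lambda,\mu$ and any partition $\alpha$, \[ K^{\mathrm{cyl}}_{\lambda/\mu,\alpha}=\sum_{\nu} d^\lambda_{\mu\nu}\,K^{\mathrm{cyl}}_{\nu,\alpha}, \] where the sum is over all $(N,L)$-partitions $\nu$ and has only finitely many nonzero terms. -/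

import Mathlib

open MvPolynomial

/-- An `(N,L)`-partition: a partition `la` of length at most `N` with `la_1 - la_N ≤ L`.
Partitions are Young diagrams; the `i`-th part `la_i` is `la.rowLen (i - 1)`, the length is
`la.colLen 0`, the size is `la.card`, and the empty partition is `⊥`. -/
def IsNLPartition (N L : ℕ) (la : YoungDiagram) : Prop :=
  la.colLen 0 ≤ N ∧ la.rowLen 0 ≤ la.rowLen (N - 1) + L

/-- The type of `(N,L)`-partitions. -/
abbrev NLPartition (N L : ℕ) : Type := {la : YoungDiagram // IsNLPartition N L la}

/-- `la/mu` is a horizontal strip: `la_1 ≥ mu_1 ≥ la_2 ≥ mu_2 ≥ ⋯`. -/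
def IsHorizontalStrip (la mu : YoungDiagram) : Prop :=
  ∀ i, mu.rowLen i ≤ la.rowLen i ∧ la.rowLen (i + 1) ≤ mu.rowLen i

/-- `la/mu` is an `(N,L)`-horizontal strip: a horizontal strip such that `la` has length at
most `N` and `la_1 - mu_N ≤ L`. -/
def IsNLHorizontalStrip (N L : ℕ) (la mu : YoungDiagram) : Prop :=
  IsHorizontalStrip la mu ∧ la.colLen 0 ≤ N ∧ la.rowLen 0 ≤ mu.rowLen (N - 1) + L

/-- The `(N,L)`-cylindric semistandard tableaux of shape `la/mu` and weight `a = (a_1, …, a_r)`: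
the sequences `mu = nu^(0), nu^(1), …, nu^(r) = la` of partitions such that each
`nu^(i)/nu^(i-1)` is an `(N,L)`-horizontal strip of size `a_i`. -/
def cylTableaux (N L : ℕ) (la mu : YoungDiagram) {r : ℕ} (a : Fin r → ℕ) :
    Set (Fin (r + 1) → YoungDiagram) :=
  {nu | nu 0 = mu ∧ nu (Fin.last r) = la ∧ ∀ i : Fin r,
    IsNLHorizontalStrip N L (nu i.succ) (nu i.castSucc) ∧
      (nu i.succ).card = (nu i.castSucc).card + a i}

/-- The set of Young diagrams contained in a given one is finite. -/
theorem finite_setOf_youngDiagram_le (la : YoungDiagram) : {mu : YoungDiagram | mu ≤ la}.Finite := by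
  refine Set.Finite.of_finite_image (f := YoungDiagram.cells)
    ((la.cells.powerset.finite_toSet).subset ?_) ?_
  · rintro _ ⟨mu, hmu, rfl⟩
    simpa using hmu
  · intro a _ b _ h
    exact YoungDiagram.ext h

/-- There are only finitely many cylindric tableaux of given shape and weight. -/
theorem cylTableaux_finite (N L : ℕ) (la mu : YoungDiagram) {r : ℕ} (a : Fin r → ℕ) :
    (cylTableaux N L la mu a).Finite := by
  refine (Set.Finite.pi' (fun _ : Fin (r + 1) => finite_setOf_youngDiagram_le la)).subset ?_
  rintro nu ⟨-, hlast, hstep⟩ i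
  have hmono : Monotone nu := by
    refine Fin.monotone_iff_le_succ.2 fun j => ?_
    rintro ⟨x, y⟩ hxy
    rw [YoungDiagram.mem_iff_lt_rowLen] at hxy ⊢
    exact hxy.trans_le (((hstep j).1.1 x).1)
  exact hlast ▸ hmono (Fin.le_last i)

/-- The number `K^cyl_{la/mu,a}` of `(N,L)`-cylindric semistandard tableaux of shape `la/mu` and
weight `a`. -/
noncomputable def Kcyl (N L : ℕ) (la mu : YoungDiagram) {r : ℕ} (a : Fin r → ℕ) : ℕ :=
  (cylTableaux N L la mu a).ncard

/-- A partition as the vector of its nonzero parts. -/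
def partVector (al : YoungDiagram) : Fin (al.colLen 0) → ℕ := fun i => al.rowLen i

/-- The ring of symmetric polynomials in `N` variables with integer coefficients. -/
abbrev SymPoly (N : ℕ) : Type := symmetricSubalgebra (Fin N) ℤ

/-- The complete homogeneous symmetric polynomial `h_k` in `N` variables, for an integer index `k`;
it is `0` for `k < 0`. -/
noncomputable def completeHomogeneous (N : ℕ) (k : ℤ) : SymPoly N :=
  if 0 ≤ k then ⟨hsymm (Fin N) ℤ k.toNat, hsymm_isSymmetric (Fin N) ℤ k.toNat⟩ else 0

/-- The Schur polynomial `s_la` in `N` variables: the Jacobi–Trudi determinant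
`det (h_{la_i - i + j})_{1 ≤ i, j ≤ N}` if `la` has length at most `N`, and `0` otherwise. -/
noncomputable def schurPoly (N : ℕ) (la : YoungDiagram) : SymPoly N :=
  if la.colLen 0 ≤ N then
    Matrix.det (Matrix.of fun i j : Fin N =>
      completeHomogeneous N ((la.rowLen i : ℤ) - (i : ℤ) + (j : ℤ)))
  else 0

/-- The ideal generated by the Schur polynomials `s_la` with `la_1 - la_N = L + 1`. -/
noncomputable def fusionIdeal (N L : ℕ) : Ideal (SymPoly N) :=
  Ideal.span {p | ∃ la : YoungDiagram,
    la.rowLen 0 = la.rowLen (N - 1) + (L + 1) ∧ p = schurPoly N la}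

/-- The fusion ring of rank `N` and level `L`. -/
abbrev FusionRing (N L : ℕ) : Type := SymPoly N ⧸ fusionIdeal N L

/-- The image `S_la` of the Schur polynomial `s_la` in the fusion ring. -/
noncomputable def fusionSchur (N L : ℕ) (la : YoungDiagram) : FusionRing N L :=
  Ideal.Quotient.mk (fusionIdeal N L) (schurPoly N la)

/-! The heart is a Pieri rule in the fusion ring (`repr_fusionStrip_mul`): for k ≤ L, multiplying
S_μ by h_k gives the sum of the S_λ with λ/μ an (N,L)-horizontal strip of size k. For k > L no such
strip exists, and 0 is used in place of h_k. Let P be the product of these elements over the entries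
of α. Iterating the rule, the coefficient of S_λ in P S_μ is K_{λ/μ,α}. For μ = ∅ this reads P = ∑
K_{ν,α} S_ν; multiplying by S_μ and taking the coefficient of S_λ proves the identity.

For the Pieri rule, a Jacobi–Trudi determinant is attached to every exponent vector z, and S_λ is
the one at z = λ + δ, with δ the staircase. The hook generators force h_{L+1} = … = h_{L+N-1} = 0.
With the linear recurrence of order N for the h_m this gives h_{m+N+L} = h_{N+L} h_m, so the
determinants are antisymmetric under affine reflections of period N+L. The product of h_k with the
determinant at z is the sum over all z + b with |b| = k. Inclusion–exclusion and reflections cancel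
every b that crosses a gap between cyclic neighbours; the remaining b are the strips
(`fusionHomogeneous_mul_fusionDet`).

The S_λ span because translations and permutations bring any z into the fundamental alcove, unless
its determinant vanishes (`fusionDet_mem`). They are independent because signed counts of affine
permutations define functionals that kill the fusion ideal (`fusionFunctional_eq_zero`) and are dual
to the S_λ (`affineSign_eq`). -/

/-! ### Complete homogeneous polynomials: generating series and recurrence -/

/-- The value of `completeHomogeneous` in the polynomial ring. -/
theorem coe_completeHomogeneous (N : ℕ) (k : ℤ) :
    (completeHomogeneous N k : MvPolynomial (Fin N) ℤ) =
      if 0 ≤ k then hsymm (Fin N) ℤ k.toNat else 0 := by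
  unfold completeHomogeneous
  split_ifs <;> rfl

theorem completeHomogeneous_of_neg {N : ℕ} {k : ℤ} (hk : k < 0) : completeHomogeneous N k = 0 :=
  if_neg (not_le.2 hk)

theorem completeHomogeneous_zero (N : ℕ) : completeHomogeneous N 0 = 1 := by
  apply Subtype.ext
  rw [coe_completeHomogeneous]
  simp

theorem coe_completeHomogeneous_natCast (N k : ℕ) :
    (completeHomogeneous N k : MvPolynomial (Fin N) ℤ) = hsymm (Fin N) ℤ k := by
  rw [coe_completeHomogeneous]
  simp

/-- `h_k` is the sum of all monomials of degree `k`. -/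
theorem hsymm_eq_sum_piAntidiag {σ R : Type*} [Fintype σ] [DecidableEq σ] [CommRing R] (k : ℕ) :
    hsymm σ R k =
      ∑ b ∈ Finset.piAntidiag Finset.univ k, ∏ i : σ, (X i : MvPolynomial σ R) ^ b i := by
  rw [← Finset.map_sym_eq_piAntidiag, Finset.sum_map, hsymm]
  simp only [Finset.sym_univ]
  refine Finset.sum_congr rfl fun s _ => ?_
  rw [Finset.prod_multiset_map_count]
  refine Finset.prod_subset (Finset.subset_univ _) fun i _ hi => ?_
  have : Multiset.count i s.1 = 0 := by simpa using hi
  rw [this, pow_zero]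

/-- The polynomial `∏ (1 - x_i t)` in `t`, over `i` in a given set of indices. -/
noncomputable def linearFactors (N : ℕ) (s : Finset (Fin N)) :
    Polynomial (MvPolynomial (Fin N) ℤ) :=
  ∏ i ∈ s, (1 - Polynomial.C (X i) * Polynomial.X)

theorem natDegree_linearFactors_le {N : ℕ} (s : Finset (Fin N)) :
    (linearFactors N s).natDegree ≤ s.card := by
  refine (Polynomial.natDegree_prod_le _ _).trans ?_
  refine (Finset.sum_le_card_nsmul _ _ 1 fun i _ => ?_).trans (by simp)
  compute_degree

/-- The generating series of the complete homogeneous symmetric polynomials. -/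
noncomputable def hsymmSeries (N : ℕ) : PowerSeries (MvPolynomial (Fin N) ℤ) :=
  PowerSeries.mk fun k => hsymm (Fin N) ℤ k

theorem hsymmSeries_eq_prod (N : ℕ) :
    hsymmSeries N = ∏ i : Fin N, PowerSeries.mk fun k => (X i : MvPolynomial (Fin N) ℤ) ^ k := by
  ext1 k
  rw [PowerSeries.coeff_prod, hsymmSeries, PowerSeries.coeff_mk, hsymm_eq_sum_piAntidiag]
  simp only [PowerSeries.coeff_mk]
  refine (Finset.sum_nbij (fun b : Fin N →₀ ℕ => ⇑b) (fun b hb => ?_)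
    (fun b _ c _ h => DFunLike.coe_injective h)
    (fun b hb => ⟨Finsupp.equivFunOnFinite.symm b, ?_, rfl⟩) fun b _ => rfl).symm
  · simpa using (Finset.mem_finsuppAntidiag.1 hb).1
  · simpa [Finset.mem_finsuppAntidiag] using hb

theorem geometric_mul_one_sub {R : Type*} [CommRing R] (a : R) :
    (PowerSeries.mk fun k => a ^ k) * (1 - PowerSeries.C a * PowerSeries.X) = 1 := by
  ext k
  rw [mul_sub, mul_one, ← mul_assoc, map_sub]
  cases k with
  | zero => simp
  | succ k => simp [PowerSeries.coeff_succ_mul_X, PowerSeries.coeff_one, pow_succ]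

theorem coe_linearFactors {N : ℕ} (s : Finset (Fin N)) :
    (linearFactors N s : PowerSeries (MvPolynomial (Fin N) ℤ)) =
      ∏ i ∈ s, (1 - PowerSeries.C (X i) * PowerSeries.X) := by
  rw [linearFactors, ← Polynomial.coeToPowerSeries.ringHom_apply, map_prod]
  simp

theorem hsymmSeries_mul_linearFactors_univ (N : ℕ) :
    hsymmSeries N * (linearFactors N Finset.univ : PowerSeries (MvPolynomial (Fin N) ℤ)) = 1 := by
  rw [coe_linearFactors, hsymmSeries_eq_prod, ← Finset.prod_mul_distrib]
  exact Finset.prod_eq_one fun i _ => geometric_mul_one_sub _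

theorem hsymmSeries_mul_linearFactors_erase {N : ℕ} (j : Fin N) :
    hsymmSeries N * (linearFactors N (Finset.univ.erase j) : PowerSeries (MvPolynomial (Fin N) ℤ)) =
      PowerSeries.mk fun k => (X j : MvPolynomial (Fin N) ℤ) ^ k := by
  rw [coe_linearFactors, hsymmSeries_eq_prod, ← Finset.mul_prod_erase _ _ (Finset.mem_univ j),
    mul_assoc, ← Finset.prod_mul_distrib,
    Finset.prod_eq_one fun i _ => geometric_mul_one_sub _, mul_one]

/-- Coefficients of the product of the series of the `h_k` with a polynomial. -/
theorem coeff_hsymmSeries_mul {N M : ℕ} (q : Polynomial (MvPolynomial (Fin N) ℤ))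
    (hq : q.natDegree < M) (m : ℕ) :
    PowerSeries.coeff m (hsymmSeries N * (q : PowerSeries (MvPolynomial (Fin N) ℤ))) =
      ∑ b ∈ Finset.range M, (completeHomogeneous N ((m : ℤ) - b) : MvPolynomial (Fin N) ℤ) *
        q.coeff b := by
  rw [mul_comm, PowerSeries.coeff_mul, Finset.Nat.sum_antidiagonal_eq_sum_range_succ_mk]
  have h1 : ∀ b ∈ Finset.range (m + 1), PowerSeries.coeff b
      (q : PowerSeries (MvPolynomial (Fin N) ℤ)) * PowerSeries.coeff (m - b) (hsymmSeries N) =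
      (completeHomogeneous N ((m : ℤ) - b) : MvPolynomial (Fin N) ℤ) * q.coeff b := by
    intro b hb
    have hb' : b ≤ m := Nat.lt_succ_iff.1 (Finset.mem_range.1 hb)
    rw [Polynomial.coeff_coe, hsymmSeries, PowerSeries.coeff_mk, ← Nat.cast_sub hb',
      coe_completeHomogeneous_natCast, mul_comm]
  rw [Finset.sum_congr rfl h1]
  -- Both sums extend to a common range: past m the index of h is negative, and past M the
  -- coefficient of q is zero.
  have h2 : ∀ K : ℕ, ∀ b ∈ Finset.range (max (m + 1) M), b ∉ Finset.range K →
      (K = m + 1 ∨ K = M) →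
      (completeHomogeneous N ((m : ℤ) - b) : MvPolynomial (Fin N) ℤ) * q.coeff b = 0 := by
    rintro K b - hbK (rfl | rfl)
    · rw [completeHomogeneous_of_neg (by simp at hbK; omega)]
      simp
    · rw [Polynomial.coeff_eq_zero_of_natDegree_lt (by simp at hbK; omega), mul_zero]
  rw [Finset.sum_subset (Finset.range_mono (le_max_left (m + 1) M))
      fun b hb hb' => h2 _ b hb hb' (.inl rfl),
    Finset.sum_subset (Finset.range_mono (le_max_right (m + 1) M))
      fun b hb hb' => h2 _ b hb hb' (.inr rfl)]

/-- The coefficients of `∏ (1 - x_i t)`, as symmetric polynomials. -/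
theorem isSymmetric_coeff_linearFactors (N k : ℕ) :
    ((linearFactors N Finset.univ).coeff k).IsSymmetric := by
  intro e
  have h : (linearFactors N Finset.univ).map ((rename e : _ →ₐ[ℤ] _) : _ →+* _) =
      linearFactors N Finset.univ := by
    rw [linearFactors, Polynomial.map_prod]
    exact Fintype.prod_equiv e _ _ fun i => by simp
  conv_rhs => rw [← h]
  rw [Polynomial.coeff_map]
  rfl

/-- The linear recurrence satisfied by the complete homogeneous symmetric polynomials. -/
theorem exists_completeHomogeneous_recurrence (N : ℕ) :
    ∃ p : ℕ → SymPoly N, ∀ m : ℤ, 0 < m → completeHomogeneous N m =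
      ∑ b ∈ Finset.range N, completeHomogeneous N (m - (b + 1 : ℕ)) * p b := by
  -- The recurrence is the coefficient of t^m, m > 0, in H(t) ∏ (1 - x_i t) = 1.
  refine ⟨fun b => -⟨_, isSymmetric_coeff_linearFactors N (b + 1)⟩, fun m hm => ?_⟩
  lift m to ℕ using hm.le
  have hm0 : m ≠ 0 := by rintro rfl; simp at hm
  have h := coeff_hsymmSeries_mul (linearFactors N Finset.univ) (M := N + 1)
    (Nat.lt_succ_iff.2 ((natDegree_linearFactors_le _).trans (by simp))) m
  rw [hsymmSeries_mul_linearFactors_univ, PowerSeries.coeff_one, if_neg hm0,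
    Finset.sum_range_succ'] at h
  have h0 : (linearFactors N Finset.univ).coeff 0 = 1 := by
    rw [linearFactors, Polynomial.coeff_zero_prod]
    simp
  rw [h0, mul_one, Nat.cast_zero, sub_zero] at h
  apply Subtype.ext
  simp only [AddSubmonoidClass.coe_finsetSum, MulMemClass.coe_mul, NegMemClass.coe_neg, mul_neg,
    Finset.sum_neg_distrib]
  exact (neg_eq_of_add_eq_zero_right h.symm).symm

/-- Powers of a variable are combinations of `N` consecutive complete homogeneous symmetric
polynomials, with coefficients independent of the exponent. -/
theorem exists_pow_eq_sum_completeHomogeneous (N : ℕ) :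
    ∃ B : Matrix (Fin N) (Fin N) (MvPolynomial (Fin N) ℤ), ∀ (m : ℕ) (j : Fin N),
      (X j : MvPolynomial (Fin N) ℤ) ^ m =
        ∑ c : Fin N, (completeHomogeneous N ((m : ℤ) - (N - 1) + (c : ℕ)) :
          MvPolynomial (Fin N) ℤ) * B c j := by
  -- H(t) ∏_{i ≠ j} (1 - x_i t) = 1/(1 - x_j t), whose coefficient of t^m is x_j^m. The sum is
  -- reversed by b = N - 1 - c.
  refine ⟨fun c j => (linearFactors N (Finset.univ.erase j)).coeff (N - 1 - c), fun m j => ?_⟩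
  have hN : 0 < N := j.pos
  have h := coeff_hsymmSeries_mul (linearFactors N (Finset.univ.erase j)) (M := N)
    ((natDegree_linearFactors_le _).trans_lt (by simp; omega)) m
  rw [hsymmSeries_mul_linearFactors_erase, PowerSeries.coeff_mk] at h
  rw [h, ← Finset.sum_range_reflect, Finset.sum_range]
  refine Finset.sum_congr rfl fun c _ => ?_
  congr 3
  have := c.2
  omega

/-! ### Jacobi–Trudi determinants and alternants -/

/-- The row `(h_{m-N+1}, …, h_m)` of a Jacobi–Trudi matrix. -/
noncomputable def jacobiTrudiRow (N m : ℕ) : Fin N → SymPoly N :=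
  fun c => completeHomogeneous N ((m : ℤ) - (N - 1) + (c : ℕ))

/-- The Jacobi–Trudi determinant attached to an arbitrary vector of exponents. -/
noncomputable def jacobiTrudi (N : ℕ) (z : Fin N → ℕ) : SymPoly N :=
  Matrix.detRowAlternating fun i => jacobiTrudiRow N (z i)

theorem jacobiTrudi_eq_det {N : ℕ} (z : Fin N → ℕ) :
    jacobiTrudi N z = Matrix.det (Matrix.of fun i => jacobiTrudiRow N (z i)) := rfl

/-- The alternant `det (x_j ^ z_i)`. -/
noncomputable def alternant (N : ℕ) (z : Fin N → ℕ) : MvPolynomial (Fin N) ℤ :=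
  Matrix.det (Matrix.of fun i j : Fin N => (X j : MvPolynomial (Fin N) ℤ) ^ z i)

/-- The staircase vector `(N-1, …, 1, 0)`. -/
def staircase (N : ℕ) : Fin N → ℕ := fun i => N - 1 - i

/-- The strictly decreasing vector attached to a partition with at most `N` parts. -/
def shiftedParts (N : ℕ) (la : YoungDiagram) : Fin N → ℕ := fun i => la.rowLen i + (N - 1 - i)

theorem schurPoly_eq_jacobiTrudi {N : ℕ} {la : YoungDiagram} (h : la.colLen 0 ≤ N) :
    schurPoly N la = jacobiTrudi N (shiftedParts N la) := by
  rw [schurPoly, if_pos h, jacobiTrudi_eq_det]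
  congr 1
  ext1 i j
  simp only [Matrix.of_apply, jacobiTrudiRow, shiftedParts]
  congr 1
  have := i.2
  omega

theorem jacobiTrudi_staircase (N : ℕ) : jacobiTrudi N (staircase N) = 1 := by
  rw [jacobiTrudi_eq_det, Matrix.det_of_isUpperTriangular]
  · refine Finset.prod_eq_one fun i _ => ?_
    have := i.2
    rw [Matrix.of_apply, jacobiTrudiRow, staircase, ← completeHomogeneous_zero N]
    congr 1
    omega
  · intro i j hij
    refine completeHomogeneous_of_neg ?_
    have := i.2
    have : (j : ℕ) < i := hij
    simp only [staircase]
    omega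

theorem alternant_comp_perm {N : ℕ} (z : Fin N → ℕ) (s : Equiv.Perm (Fin N)) :
    alternant N (z ∘ s) = Equiv.Perm.sign s • alternant N z :=
  AlternatingMap.map_perm Matrix.detRowAlternating
    (fun i j : Fin N => (X j : MvPolynomial (Fin N) ℤ) ^ z i) s

/-- The matrix (x_j^{z_i}) is the Jacobi–Trudi matrix of z times a matrix B independent of z; D is
det B. -/
theorem exists_jacobiTrudi_mul_eq_alternant (N : ℕ) :
    ∃ D : MvPolynomial (Fin N) ℤ, ∀ z, (jacobiTrudi N z : MvPolynomial (Fin N) ℤ) * D =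
      alternant N z := by
  obtain ⟨B, hB⟩ := exists_pow_eq_sum_completeHomogeneous N
  refine ⟨B.det, fun z => ?_⟩
  rw [jacobiTrudi_eq_det, alternant]
  have h1 : ∀ M : Matrix (Fin N) (Fin N) (SymPoly N),
      ((Matrix.det M : SymPoly N) : MvPolynomial (Fin N) ℤ) =
        Matrix.det (M.map fun x => (x : MvPolynomial (Fin N) ℤ)) := fun M =>
    (symmetricSubalgebra (Fin N) ℤ).val.map_det M
  rw [h1, ← Matrix.det_mul]
  congr 1
  ext1 i j
  rw [Matrix.of_apply, hB, Matrix.mul_apply]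
  rfl

theorem alternant_ne_zero (N : ℕ) : alternant N (staircase N) ≠ 0 := by
  have h : alternant N (fun i => (i : ℕ)) ≠ 0 := by
    have h2 : alternant N (fun i => (i : ℕ)) =
        Matrix.det (Matrix.vandermonde fun i : Fin N => (X i : MvPolynomial (Fin N) ℤ)) := by
      rw [← Matrix.det_transpose]
      rfl
    rw [h2, Matrix.det_vandermonde_ne_zero_iff]
    exact X_injective
  have h3 : (fun i : Fin N => (i : ℕ)) = staircase N ∘ Fin.revPerm := by
    ext i
    simp [staircase]
    omega
  rw [h3, alternant_comp_perm] at h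
  rintro h0
  exact h (by rw [h0, smul_zero])

/-- The bialternant formula. -/
theorem jacobiTrudi_mul_alternant {N : ℕ} (z : Fin N → ℕ) :
    (jacobiTrudi N z : MvPolynomial (Fin N) ℤ) * alternant N (staircase N) = alternant N z := by
  obtain ⟨D, hD⟩ := exists_jacobiTrudi_mul_eq_alternant N
  have h := hD (staircase N)
  -- Taking z to be the staircase identifies D as the Vandermonde alternant.
  rw [jacobiTrudi_staircase, OneMemClass.coe_one, one_mul] at h
  rw [← h, hD]

theorem alternant_eq_sum {N : ℕ} (z : Fin N → ℕ) :
    alternant N z = ∑ s : Equiv.Perm (Fin N), (Equiv.Perm.sign s : ℤ) •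
      rename s (∏ i, (X i : MvPolynomial (Fin N) ℤ) ^ z i) := by
  rw [alternant, ← Matrix.det_transpose, Matrix.det_apply]
  refine Finset.sum_congr rfl fun s _ => ?_
  simp [Units.smul_def]

/-- The product of an alternant and a symmetric polynomial. -/
theorem mul_alternant {N : ℕ} {f : MvPolynomial (Fin N) ℤ} (hf : f.IsSymmetric)
    {S : Finset (Fin N → ℕ)} {c : (Fin N → ℕ) → ℤ}
    (hS : f = ∑ b ∈ S, c b • ∏ i, (X i : MvPolynomial (Fin N) ℤ) ^ b i) (z : Fin N → ℕ) :
    f * alternant N z = ∑ b ∈ S, c b • alternant N (z + b) := by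
  simp only [alternant_eq_sum, Finset.mul_sum, Finset.smul_sum]
  rw [Finset.sum_comm]
  refine Finset.sum_congr rfl fun s _ => ?_
  rw [mul_smul_comm]
  -- By symmetry f can be replaced by its renaming under s, so it is expanded inside the s-th term.
  conv_lhs => rw [← hf s, ← map_mul, hS, Finset.sum_mul, map_sum, Finset.smul_sum]
  refine Finset.sum_congr rfl fun b _ => ?_
  rw [smul_mul_assoc, map_zsmul, smul_comm, ← Finset.prod_mul_distrib]
  congr 3
  refine Finset.prod_congr rfl fun i _ => ?_
  rw [Pi.add_apply, pow_add, mul_comm]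

/-- The rule for alternants transfers through the bialternant formula, since the Vandermonde
alternant is nonzero in a domain. -/
theorem mul_jacobiTrudi {N : ℕ} (f : SymPoly N)
    {S : Finset (Fin N → ℕ)} {c : (Fin N → ℕ) → ℤ}
    (hS : (f : MvPolynomial (Fin N) ℤ) = ∑ b ∈ S, c b • ∏ i, (X i : MvPolynomial (Fin N) ℤ) ^ b i)
    (z : Fin N → ℕ) :
    f * jacobiTrudi N z = ∑ b ∈ S, c b • jacobiTrudi N (z + b) := by
  apply Subtype.ext
  refine mul_right_cancel₀ (alternant_ne_zero N) ?_
  rw [MulMemClass.coe_mul, mul_assoc, jacobiTrudi_mul_alternant, mul_alternant f.2 hS,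
    AddSubmonoidClass.coe_finsetSum, Finset.sum_mul]
  refine Finset.sum_congr rfl fun b _ => ?_
  rw [← jacobiTrudi_mul_alternant (z + b)]
  simp [mul_assoc]

theorem eq_sum_support_smul_prod {N : ℕ} (f : MvPolynomial (Fin N) ℤ) :
    f = ∑ b ∈ f.support.map ⟨_, DFunLike.coe_injective⟩,
      f.coeff (Finsupp.equivFunOnFinite.symm b) • ∏ i, (X i : MvPolynomial (Fin N) ℤ) ^ b i := by
  conv_lhs => rw [f.as_sum]
  rw [Finset.sum_map]
  refine Finset.sum_congr rfl fun b _ => ?_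
  rw [Function.Embedding.coeFn_mk, monomial_eq, Finsupp.prod_fintype _ _ (by simp),
    smul_eq_C_mul,
    show Finsupp.equivFunOnFinite.symm ⇑b = b from Finsupp.equivFunOnFinite.symm_apply_apply b]

/-- The Pieri rule before cancellation. -/
theorem completeHomogeneous_mul_jacobiTrudi {N : ℕ} (k : ℕ) (z : Fin N → ℕ) :
    completeHomogeneous N k * jacobiTrudi N z =
      ∑ b ∈ Finset.piAntidiag Finset.univ k, jacobiTrudi N (z + b) := by
  rw [mul_jacobiTrudi (c := fun _ => 1) (S := Finset.piAntidiag Finset.univ k)]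
  · simp
  · rw [coe_completeHomogeneous_natCast, hsymm_eq_sum_piAntidiag]
    simp

theorem span_range_jacobiTrudi (N : ℕ) : Submodule.span ℤ (Set.range (jacobiTrudi N)) = ⊤ := by
  refine eq_top_iff.2 fun f _ => ?_
  rw [← mul_one f, ← jacobiTrudi_staircase, mul_jacobiTrudi f (eq_sum_support_smul_prod _)]
  exact Submodule.sum_mem _ fun b _ => Submodule.smul_mem _ _ (Submodule.subset_span ⟨_, rfl⟩)

/-! ### Young diagrams through their row lengths -/

namespace YoungDiagram

theorem ext_rowLen {la mu : YoungDiagram} (h : ∀ i, la.rowLen i = mu.rowLen i) : la = mu := by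
  ext ⟨i, j⟩
  rw [mem_cells, mem_cells, mem_iff_lt_rowLen, mem_iff_lt_rowLen, h]

theorem rowLen_bot (i : ℕ) : (⊥ : YoungDiagram).rowLen i = 0 := by
  by_contra h
  exact notMem_bot _ (mem_iff_lt_rowLen.2 (Nat.pos_of_ne_zero h))

theorem colLen_zero_le_iff {la : YoungDiagram} {N : ℕ} : la.colLen 0 ≤ N ↔ la.rowLen N = 0 := by
  rw [← not_lt, ← mem_iff_lt_colLen, mem_iff_lt_rowLen, Nat.pos_iff_ne_zero, not_not]

theorem rowLen_eq_zero_of_le {la : YoungDiagram} {N i : ℕ} (h : la.colLen 0 ≤ N) (hi : N ≤ i) :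
    la.rowLen i = 0 :=
  colLen_zero_le_iff.1 (h.trans hi)

theorem exists_rowLen_eq {f : ℕ → ℕ} (hf : Antitone f) {M : ℕ} (hM : f M = 0) :
    ∃ la : YoungDiagram, ∀ i, la.rowLen i = f i := by
  let la : YoungDiagram :=
    { cells := (Finset.range M ×ˢ Finset.range (f 0)).filter fun c => c.2 < f c.1
      isLowerSet := by
        rintro ⟨i, j⟩ ⟨i', j'⟩ ⟨hi, hj⟩ h
        simp only [Finset.coe_filter, Finset.mem_product, Finset.mem_range, Set.mem_ofPred_eq]
          at h hi hj ⊢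
        have := hf hi
        omega }
  have hmem : ∀ i j, (i, j) ∈ la ↔ j < f i := by
    intro i j
    rw [← mem_cells]
    simp only [la, Finset.mem_filter, Finset.mem_product, Finset.mem_range]
    refine ⟨fun h => h.2, fun h => ⟨⟨?_, h.trans_le (hf i.zero_le)⟩, h⟩⟩
    by_contra hi
    have := hf (not_lt.1 hi)
    omega
  refine ⟨la, fun i => ?_⟩
  refine eq_of_forall_lt_iff fun j => ?_
  rw [← mem_iff_lt_rowLen, hmem]

theorem card_eq_sum_rowLen {la : YoungDiagram} {N : ℕ} (h : la.colLen 0 ≤ N) :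
    la.card = ∑ i : Fin N, la.rowLen i := by
  rw [← Finset.sum_range fun i => la.rowLen i, YoungDiagram.card,
    Finset.card_eq_sum_card_fiberwise (f := Prod.fst) (t := Finset.range N)]
  · exact Finset.sum_congr rfl fun i _ => (la.rowLen_eq_card (i := i)).symm
  · rintro ⟨i, j⟩ hij
    rw [Finset.mem_coe, Finset.mem_range]
    have := mem_iff_lt_rowLen.1 ((mem_cells _).1 hij)
    by_contra hi
    rw [rowLen_eq_zero_of_le h (not_lt.1 hi)] at this
    omega

end YoungDiagram

/-! ### Determinants at level L: affine antisymmetry and cancellation -/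

section Fusion

variable {Q : Type*} [CommRing Q] {N L : ℕ}

/-- A homomorphism from symmetric polynomials kills the generators of the fusion ideal. -/
def VanishesAtLevel (q : SymPoly N →+* Q) (L : ℕ) : Prop :=
  ∀ la : YoungDiagram, la.rowLen 0 = la.rowLen (N - 1) + (L + 1) → q (schurPoly N la) = 0

/-- The image of `h_k` under a homomorphism. -/
noncomputable def fusionHomogeneous (q : SymPoly N →+* Q) (k : ℤ) : Q :=
  q (completeHomogeneous N k)

/-- The image of the row `(h_{m-N+1}, …, h_m)` under a homomorphism. -/
noncomputable def fusionRow (q : SymPoly N →+* Q) (m : ℕ) : Fin N → Q :=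
  fun c => fusionHomogeneous q ((m : ℤ) - (N - 1) + (c : ℕ))

/-- The image of a Jacobi–Trudi determinant under a homomorphism. -/
noncomputable def fusionDet (q : SymPoly N →+* Q) (z : Fin N → ℕ) : Q :=
  Matrix.detRowAlternating fun i => fusionRow q (z i)

variable {q : SymPoly N →+* Q}

theorem fusionDet_eq_det (q : SymPoly N →+* Q) (z : Fin N → ℕ) :
    fusionDet q z = Matrix.det (Matrix.of fun i => fusionRow q (z i)) := rfl

theorem map_jacobiTrudi (q : SymPoly N →+* Q) (z : Fin N → ℕ) :
    q (jacobiTrudi N z) = fusionDet q z := by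
  rw [jacobiTrudi_eq_det, RingHom.map_det]
  rfl

theorem map_schurPoly (q : SymPoly N →+* Q) {la : YoungDiagram} (h : la.colLen 0 ≤ N) :
    q (schurPoly N la) = fusionDet q (shiftedParts N la) := by
  rw [schurPoly_eq_jacobiTrudi h, map_jacobiTrudi]

theorem fusionDet_comp_perm (z : Fin N → ℕ) (s : Equiv.Perm (Fin N)) :
    fusionDet q (z ∘ s) = Equiv.Perm.sign s • fusionDet q z :=
  AlternatingMap.map_perm Matrix.detRowAlternating (fun i => fusionRow q (z i)) s

theorem fusionDet_comp_swap (z : Fin N → ℕ) {i j : Fin N} (h : i ≠ j) :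
    fusionDet q (z ∘ Equiv.swap i j) = -fusionDet q z :=
  AlternatingMap.map_swap Matrix.detRowAlternating (fun i => fusionRow q (z i)) h

theorem fusionDet_eq_zero {z : Fin N → ℕ} {i j : Fin N} (h : i ≠ j) (hz : z i = z j) :
    fusionDet q z = 0 :=
  AlternatingMap.map_eq_zero_of_eq Matrix.detRowAlternating (fun i => fusionRow q (z i))
    (by rw [hz]) h

theorem fusionHomogeneous_of_neg {k : ℤ} (hk : k < 0) : fusionHomogeneous q k = 0 := by
  rw [fusionHomogeneous, completeHomogeneous_of_neg hk, map_zero]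

theorem fusionHomogeneous_zero (q : SymPoly N →+* Q) : fusionHomogeneous q 0 = 1 := by
  rw [fusionHomogeneous, completeHomogeneous_zero, map_one]

/-- The hooks with arm `L + 1` give the vanishing of `h_{L+1}, …, h_{L+N-1}`. -/
theorem VanishesAtLevel.fusionHomogeneous_eq_zero (hq : VanishesAtLevel q L) : ∀ j : ℕ, j + 1 < N →
    fusionHomogeneous q ((L + 1 + j : ℕ) : ℤ) = 0 := by
  intro j
  induction j using Nat.strong_induction_on with
  | _ j ih =>
  intro hj
  obtain ⟨la, hla⟩ := YoungDiagram.exists_rowLen_eq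
    (f := fun i => if i = 0 then L + 1 else if i ≤ j then 1 else 0) (M := N)
    (by intro a b hab; dsimp only; split_ifs <;> omega) (by split_ifs <;> omega)
  have hcol : la.colLen 0 ≤ N := by
    rw [YoungDiagram.colLen_zero_le_iff, hla]
    split_ifs <;> omega
  have hzero : q (schurPoly N la) = 0 := by
    refine hq la ?_
    rw [hla, hla]
    split_ifs <;> omega
  let jj : Fin N := ⟨j, by omega⟩
  have : NeZero N := ⟨by omega⟩
  -- For the hook (L+1, 1^j), moving the first row down to position j turns the other rows into
  -- (h_{c-i}) and row j into (h_{L+1+c}). By induction the entries of row j left of the diagonal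
  -- vanish, so the matrix is triangular with determinant h_{L+1+j}.
  have hcycle : ∀ i : Fin N, (shiftedParts N la (Fin.cycleRange jj i) : ℤ) =
      if i = jj then (L + N : ℤ) else (N : ℤ) - 1 - (i : ℕ) := by
    intro i
    have hi := i.2
    rcases lt_trichotomy i jj with h | h | h
    · have hij : (i : ℕ) < j := h
      rw [if_neg h.ne, shiftedParts, hla, Fin.coe_cycleRange_of_lt h]
      rw [if_neg (by omega), if_pos (by omega)]
      omega
    · rw [if_pos h, h, Fin.cycleRange_self, shiftedParts, hla]
      simp
      omega
    · have hij : j < (i : ℕ) := h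
      rw [if_neg h.ne', shiftedParts, Fin.cycleRange_of_gt h, hla]
      rw [if_neg (by omega), if_neg (by omega)]
      omega
  have hdet : fusionDet q (shiftedParts N la ∘ Fin.cycleRange jj) =
      fusionHomogeneous q ((L + 1 + j : ℕ) : ℤ) := by
    rw [fusionDet_eq_det, Matrix.det_of_isUpperTriangular, Finset.prod_eq_single jj]
    · rw [Matrix.of_apply, fusionRow, Function.comp_apply, hcycle, if_pos rfl]
      congr 1
      simp only [jj]
      omega
    · intro i _ hi
      rw [Matrix.of_apply, fusionRow, Function.comp_apply, hcycle, if_neg hi,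
        ← fusionHomogeneous_zero q]
      congr 1
      omega
    · simp
    · intro i c hic
      have hic' : (c : ℕ) < i := hic
      rw [Matrix.of_apply, fusionRow, Function.comp_apply, hcycle]
      split_ifs with h
      · subst h
        rw [← ih c hic' (by simp only [jj] at hic'; omega)]
        congr 1
        push_cast
        ring
      · exact fusionHomogeneous_of_neg (by omega)
  rw [← hdet, fusionDet_comp_perm, ← map_schurPoly q hcol, hzero, smul_zero]

/-- Quasi-periodicity of the complete homogeneous symmetric polynomials in the fusion ring. -/
theorem VanishesAtLevel.fusionHomogeneous_add (hq : VanishesAtLevel q L) (m : ℤ)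
    (hm : -(N : ℤ) < m) :
    fusionHomogeneous q (m + (N + L : ℕ)) =
      fusionHomogeneous q (N + L : ℕ) * fusionHomogeneous q m := by
  obtain ⟨p, hp⟩ := exists_completeHomogeneous_recurrence N
  have hp' : ∀ m : ℤ, 0 < m → fusionHomogeneous q m = ∑ b ∈ Finset.range N,
      fusionHomogeneous q (m - (b + 1 : ℕ)) * q (p b) := by
    intro m hm
    simp only [fusionHomogeneous]
    rw [hp m hm, map_sum]
    simp only [map_mul]
  obtain ⟨k, rfl⟩ : ∃ k : ℕ, m = (k : ℤ) - N + 1 := ⟨(m + N - 1).toNat, by omega⟩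
  clear hm
  induction k using Nat.strong_induction_on with
  | _ k ih =>
  -- For -N < m < 0 the left side is one of the vanishing h_{L+1}, …, h_{L+N-1}; m = 0 is trivial;
  -- for m > 0 both sides obey the same recurrence.
  rcases lt_trichotomy ((k : ℤ) - N + 1) 0 with h | h | h
  · rw [fusionHomogeneous_of_neg h, mul_zero, ← hq.fusionHomogeneous_eq_zero k (by omega)]
    congr 1
    push_cast
    ring
  · rw [h, fusionHomogeneous_zero, zero_add, mul_one]
  · rw [hp' _ h, hp' _ (by omega), Finset.mul_sum]
    refine Finset.sum_congr rfl fun b hb => ?_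
    have hb := Finset.mem_range.1 hb
    have h1 := ih (k - (b + 1)) (by omega)
    rw [Nat.cast_sub (by omega)] at h1
    rw [← mul_assoc, ← sub_add_eq_add_sub, show (k : ℤ) - N + 1 - (b + 1 : ℕ) =
      k - (b + 1 : ℕ) - N + 1 by ring, h1]

theorem VanishesAtLevel.fusionRow_add (hq : VanishesAtLevel q L) (m : ℕ) :
    fusionRow q (m + (N + L)) = fusionHomogeneous q (N + L : ℕ) • fusionRow q m := by
  ext1 c
  rw [Pi.smul_apply, smul_eq_mul, fusionRow, fusionRow, ← hq.fusionHomogeneous_add _ (by omega)]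
  congr 1
  push_cast
  ring

/-- Quasi-periodicity of the determinants in each entry of the vector of exponents. -/
theorem VanishesAtLevel.fusionDet_update_add (hq : VanishesAtLevel q L) (z : Fin N → ℕ)
    (i : Fin N) (m : ℕ) :
    fusionDet q (Function.update z i (m + (N + L))) =
      fusionHomogeneous q (N + L : ℕ) * fusionDet q (Function.update z i m) := by
  have h : ∀ k, (fun j => fusionRow q (Function.update z i k j)) =
      Function.update (fun j => fusionRow q (z j)) i (fusionRow q k) := by
    intro k
    ext1 j
    rcases eq_or_ne j i with rfl | hj
    · simp
    · simp [hj]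
  rw [fusionDet, fusionDet, h, h, hq.fusionRow_add, AlternatingMap.map_update_smul, smul_eq_mul]

theorem fusionDet_comp_perm' (z : Fin N → ℕ) (s : Equiv.Perm (Fin N)) :
    fusionDet q z = Equiv.Perm.sign s • fusionDet q (z ∘ s) := by
  rw [fusionDet_comp_perm, smul_smul, Int.units_mul_self, one_smul]

/-- Antisymmetry of the determinants under affine reflections. -/
theorem VanishesAtLevel.fusionDet_add_reflection (hq : VanishesAtLevel q L) (z : Fin N → ℕ)
    {i p : Fin N} (hip : i ≠ p) (u v : ℕ) {e : ℕ} (he : e = 0 ∨ e = N + L) :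
    fusionDet q (Function.update (Function.update z p v) i (u + e)) +
      fusionDet q (Function.update (Function.update z p u) i (v + e)) = 0 := by
  have h0 : fusionDet q (Function.update (Function.update z p v) i u) +
      fusionDet q (Function.update (Function.update z p u) i v) = 0 := by
    have : Function.update (Function.update z p u) i v =
        Function.update (Function.update z p v) i u ∘ Equiv.swap i p := by
      ext j
      rcases eq_or_ne j i with rfl | hji
      · simp [hip.symm]
      rcases eq_or_ne j p with rfl | hjp
      · simp [hip.symm]
      · simp [Equiv.swap_apply_of_ne_of_ne hji hjp, hji, hjp]
    rw [this, fusionDet_comp_swap _ hip, add_neg_cancel]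
  rcases he with rfl | rfl
  · exact h0
  · rw [hq.fusionDet_update_add, hq.fusionDet_update_add, ← mul_add, h0, mul_zero]

/-- The determinants vanish on the walls of the affine reflections. -/
theorem VanishesAtLevel.fusionDet_eq_zero_of_add (hq : VanishesAtLevel q L) {z : Fin N → ℕ}
    {i p : Fin N} (hip : i ≠ p) {e : ℕ} (he : e = 0 ∨ e = N + L) (hz : z i = z p + e) :
    fusionDet q z = 0 := by
  rcases he with rfl | rfl
  · exact fusionDet_eq_zero hip hz
  · rw [← Function.update_eq_self i z, hz, hq.fusionDet_update_add,
      fusionDet_eq_zero hip (by simp [hip.symm]), mul_zero]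

/-- Inclusion–exclusion, by expanding ∏ (1 - 1_{P i}). -/
theorem sum_filter_forall_not {ι κ R : Type*} [Fintype ι] [DecidableEq ι] [CommRing R]
    (S : Finset κ) (F : κ → R) (P : ι → κ → Prop)
    [∀ i b, Decidable (P i b)] [DecidablePred fun b => ∀ i, ¬ P i b]
    [∀ T : Finset ι, DecidablePred fun b => ∀ i ∈ T, P i b] :
    ∑ b ∈ S with ∀ i, ¬ P i b, F b =
      ∑ T : Finset ι, (-1) ^ T.card * ∑ b ∈ S with ∀ i ∈ T, P i b, F b := by
  have h : ∀ b, (if ∀ i, ¬ P i b then F b else 0) =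
      ∑ T : Finset ι, (-1) ^ T.card * if ∀ i ∈ T, P i b then F b else 0 := by
    intro b
    have h1 : ∏ i : ι, (1 + -(if P i b then (1 : R) else 0)) = if ∀ i, ¬ P i b then 1 else 0 := by
      trans ∏ i : ι, if ¬ P i b then (1 : R) else 0
      · refine Finset.prod_congr rfl fun i _ => ?_
        split_ifs <;> simp
      · rw [Fintype.prod_boole]
        congr
    rw [← mul_boole, ← h1, Finset.prod_one_add, Finset.powerset_univ, mul_comm, Finset.sum_mul]
    refine Finset.sum_congr rfl fun T _ => ?_
    rw [Finset.prod_neg, Finset.prod_boole, mul_assoc, boole_mul]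
    congr
  simp only [Finset.sum_filter, h, Finset.mul_sum]
  exact Finset.sum_comm

/-- Cancellation in the Pieri rule: only the vectors within the given gaps contribute. -/
theorem VanishesAtLevel.fusionHomogeneous_mul_fusionDet (hq : VanishesAtLevel q L)
    (x g : Fin N → ℕ) (r : Fin N → Fin N)
    (hr : ∀ T : Finset (Fin N), T.Nonempty → (∀ i ∈ T, r i ∈ T) → T = Finset.univ)
    (hg : ∀ i, ∃ e, (e = 0 ∨ e = N + L) ∧ x i + g i = x (r i) + e)
    {k : ℕ} (hk : k < ∑ i, g i) :
    fusionHomogeneous q k * fusionDet q x =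
      ∑ b ∈ Finset.piAntidiag Finset.univ k with ∀ i, ¬ g i ≤ b i, fusionDet q (x + b) := by
  -- T is a set of indices at which b is required to reach its gap. The term T = ∅ is the full
  -- product, and all others vanish.
  rw [sum_filter_forall_not _ _ (fun i (b : Fin N → ℕ) => g i ≤ b i), Finset.sum_eq_single ∅]
  · rw [fusionHomogeneous, ← map_jacobiTrudi, ← map_mul, completeHomogeneous_mul_jacobiTrudi,
      map_sum]
    simp [map_jacobiTrudi]
  · intro T _ hT
    by_cases hTu : T = Finset.univ
    -- Reaching every gap would need |b| ≥ ∑ g_i > k.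
    · rw [Finset.filter_false_of_mem, Finset.sum_empty, mul_zero]
      intro b hb hTb
      have hsum : ∑ i, b i = k := by simpa using hb
      have hle : ∑ i, g i ≤ ∑ i, b i :=
        Finset.sum_le_sum fun i _ => hTb i (hTu ▸ Finset.mem_univ i)
      omega
    · obtain ⟨i, hiT, hriT⟩ : ∃ i ∈ T, r i ∉ T := by
        by_contra! h
        exact hTu (hr T (Finset.nonempty_iff_ne_empty.2 hT) h)
      have hip : i ≠ r i := fun h => hriT (h ▸ hiT)
      obtain ⟨e, he, hge⟩ := hg i
      -- With p = r i, this is the reflection exchanging x_i + b_i - e and x_p + b_p. It preserves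
      -- the conditions indexed by T: the new entry at i is at least g_i, and p is not in T.
      rw [Finset.sum_involution (fun b _ => Function.update (Function.update b (r i)
        (b i - g i)) i (b (r i) + g i)), mul_zero]
      · intro b hb
        have hbi : g i ≤ b i := (Finset.mem_filter.1 hb).2 i hiT
        have := hq.fusionDet_add_reflection (x + b) hip (x (r i) + (b i - g i))
          (x (r i) + b (r i)) he
        convert this using 3
        · ext j
          rcases eq_or_ne j i with rfl | hji
          · simp; omega
          rcases eq_or_ne j (r i) with rfl | hjp
          · simp [hip.symm]
          · simp [hji, hjp]
        · ext j
          rcases eq_or_ne j i with rfl | hji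
          · simp; omega
          rcases eq_or_ne j (r i) with rfl | hjp
          · simp [hip.symm]
          · simp [hji, hjp]
      -- A fixed point lies on the reflecting wall, where the determinant is zero.
      · intro b hb hne heq
        refine hne (hq.fusionDet_eq_zero_of_add hip he ?_)
        have := congrFun heq i
        simp only [Function.update_self] at this
        simp only [Pi.add_apply]
        omega
      · intro b hb
        obtain ⟨hb, hbT⟩ := Finset.mem_filter.1 hb
        have hbi := hbT i hiT
        refine Finset.mem_filter.2 ⟨?_, fun j hj => ?_⟩
        · have hsum : ∑ i, b i = k := by simpa using hb
          rw [Finset.mem_piAntidiag]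
          refine ⟨?_, by simp⟩
          rw [← hsum, ← Finset.add_sum_erase _ _ (Finset.mem_univ i),
            ← Finset.add_sum_erase (Finset.univ.erase i) _
              (Finset.mem_erase.2 ⟨hip.symm, Finset.mem_univ (r i)⟩),
            ← Finset.add_sum_erase _ b (Finset.mem_univ i),
            ← Finset.add_sum_erase (Finset.univ.erase i) b
              (Finset.mem_erase.2 ⟨hip.symm, Finset.mem_univ (r i)⟩),
            Finset.sum_congr rfl (g := fun j => b j)]
          · simp [hip.symm]
            omega
          · intro j hj
            simp only [Finset.mem_erase] at hj
            simp [hj.1, hj.2.1]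
        · rcases eq_or_ne j i with rfl | hji
          · simp
          have hjp : j ≠ r i := fun h => hriT (h ▸ hj)
          simpa [hji, hjp] using hbT j hj
      · intro b hb
        have hbi : g i ≤ b i := (Finset.mem_filter.1 hb).2 i hiT
        ext j
        rcases eq_or_ne j i with rfl | hji
        · simp [hip.symm, hbi]
        rcases eq_or_ne j (r i) with rfl | hjp
        · simp [hip.symm]
        · simp [hji, hjp]
  · simp

/-- Every determinant is, up to sign, zero or attached to a vector in the fundamental alcove. -/
theorem VanishesAtLevel.fusionDet_mem (hq : VanishesAtLevel q L) {M : Submodule ℤ Q}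
    (hM : ∀ z : Fin N → ℕ, StrictAnti z → (∀ i j, z i < z j + (N + L)) → fusionDet q z ∈ M)
    (z : Fin N → ℕ) : fusionDet q z ∈ M := by
  -- If z_i - z_j > N + L, moving N + L from z_i to z_j keeps the determinant, the two factors
  -- h_{N+L} balancing, and lowers the sum of squares.
  induction hn : ∑ i, z i ^ 2 using Nat.strong_induction_on generalizing z with
  | _ n ih =>
  subst hn
  by_cases h1 : ∃ i j, i ≠ j ∧ z i = z j
  · obtain ⟨i, j, hij, h⟩ := h1
    rw [fusionDet_eq_zero hij h]
    exact M.zero_mem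
  by_cases h2 : ∃ i j, i ≠ j ∧ z j + (N + L) ≤ z i
  · obtain ⟨i, j, hij, h⟩ := h2
    rcases h.eq_or_lt with h | h
    · rw [hq.fusionDet_eq_zero_of_add hij (.inr rfl) h.symm]
      exact M.zero_mem
    · have hz : fusionDet q z = fusionDet q
          (Function.update (Function.update z i (z i - (N + L))) j (z j + (N + L))) := by
        have e1 := hq.fusionDet_update_add z i (z i - (N + L))
        have e2 := hq.fusionDet_update_add (Function.update z i (z i - (N + L))) j (z j)
        rw [Nat.sub_add_cancel (by omega), Function.update_eq_self] at e1
        rw [e1, e2]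
        congr 2
        ext l
        rcases eq_or_ne l j with rfl | hl
        · simp [hij.symm]
        · simp [hl]
      rw [hz]
      refine ih _ ?_ _ rfl
      rw [← Finset.add_sum_erase _ _ (Finset.mem_univ i),
        ← Finset.add_sum_erase (Finset.univ.erase i) _
          (Finset.mem_erase.2 ⟨hij.symm, Finset.mem_univ j⟩),
        ← Finset.add_sum_erase _ (fun i => z i ^ 2) (Finset.mem_univ i),
        ← Finset.add_sum_erase (Finset.univ.erase i) (fun i => z i ^ 2)
          (Finset.mem_erase.2 ⟨hij.symm, Finset.mem_univ j⟩),
        Finset.sum_congr rfl (g := fun i => z i ^ 2)]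
      · simp only [Function.update_self, Function.update_of_ne hij]
        obtain ⟨d, hd⟩ := Nat.exists_eq_add_of_lt h
        have : z i - (N + L) = z j + d + 1 := by omega
        rw [this, hd]
        have := i.pos
        nlinarith
      · intro l hl
        simp only [Finset.mem_erase] at hl
        simp [hl.1, hl.2.1]
  push Not at h1 h2
  have hinj : Function.Injective z := fun i j h => by
    by_contra hij
    exact h1 i j hij h
  rw [fusionDet_comp_perm' z (Fin.revPerm.trans (Tuple.sort z)), Units.smul_def]
  refine M.smul_mem _ (hM _ ?_ fun i j => ?_)
  · have hmono : StrictMono (z ∘ Tuple.sort z) :=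
      (Tuple.monotone_sort z).strictMono_of_injective (hinj.comp (Tuple.sort z).injective)
    exact fun i j hij => hmono (Fin.rev_lt_rev.2 hij)
  · have := i.pos
    rcases eq_or_ne i j with rfl | hij
    · omega
    · exact h2 _ _ (by simpa using hij)

end Fusion

/-! ### Partitions as strictly decreasing vectors -/

theorem shiftedParts_strictAnti (N : ℕ) (la : YoungDiagram) : StrictAnti (shiftedParts N la) := by
  intro i j hij
  have h : (i : ℕ) < j := hij
  have := la.rowLen_anti i j h.le
  have := j.2
  simp only [shiftedParts]
  omega

theorem eq_of_shiftedParts_eq {N : ℕ} {la mu : YoungDiagram} (hla : la.colLen 0 ≤ N)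
    (hmu : mu.colLen 0 ≤ N) (h : shiftedParts N la = shiftedParts N mu) : la = mu := by
  refine YoungDiagram.ext_rowLen fun i => ?_
  by_cases hi : i < N
  · have := congrFun h ⟨i, hi⟩
    simp only [shiftedParts] at this
    omega
  · rw [YoungDiagram.rowLen_eq_zero_of_le hla (not_lt.1 hi),
      YoungDiagram.rowLen_eq_zero_of_le hmu (not_lt.1 hi)]

theorem exists_shiftedParts_eq {N : ℕ} {z : Fin N → ℕ} (hz : StrictAnti z) :
    ∃ la : YoungDiagram, la.colLen 0 ≤ N ∧ shiftedParts N la = z := by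
  -- A strictly decreasing vector of naturals dominates the staircase, so the subtraction below is
  -- not truncated.
  have hge : ∀ k, ∀ i : Fin N, N - 1 - (i : ℕ) = k → k ≤ z i := by
    intro k
    induction k with
    | zero => intro i _; exact Nat.zero_le _
    | succ k ih =>
      intro i hi
      have h1 := ih ⟨i + 1, by omega⟩ (by simp; omega)
      have h2 : z ⟨i + 1, by omega⟩ < z i := hz (Fin.lt_def.2 (Nat.lt_succ_self _))
      omega
  obtain ⟨la, hla⟩ := YoungDiagram.exists_rowLen_eq
    (f := fun i => if h : i < N then z ⟨i, h⟩ - (N - 1 - i) else 0) (M := N)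
    (by
      refine antitone_nat_of_succ_le fun i => ?_
      split_ifs with h1 h2
      · have h2 : z ⟨i + 1, h1⟩ < z ⟨i, h2⟩ := hz (Fin.lt_def.2 (Nat.lt_succ_self _))
        omega
      all_goals omega) (by simp)
  refine ⟨la, YoungDiagram.colLen_zero_le_iff.2 (by simp [hla]), ?_⟩
  ext i
  have := hge _ i rfl
  simp only [shiftedParts, hla, i.2, dif_pos, Fin.eta]
  omega

/-- The largest difference of shifted parts is λ_1 - λ_N + N - 1, so the level condition says that
they lie in the alcove of width N + L. -/
theorem isNLPartition_iff {N L : ℕ} (hN : 0 < N) {la : YoungDiagram} :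
    IsNLPartition N L la ↔ la.colLen 0 ≤ N ∧
      ∀ i j, shiftedParts N la i < shiftedParts N la j + (N + L) := by
  refine and_congr_right fun _ => ⟨fun h i j => ?_, fun h => ?_⟩
  · have h1 := la.rowLen_anti 0 i i.1.zero_le
    have h2 := la.rowLen_anti j (N - 1) (by omega)
    simp only [shiftedParts]
    omega
  · have := h ⟨0, hN⟩ ⟨N - 1, by omega⟩
    simp only [shiftedParts] at this
    omega

/-! ### Functionals dual to the Schur classes -/

/-- The signed count of the affine permutations (with respect to translations by multiples of `n`
with zero sum) taking the vector `x` to the vector `z`, for `x` with distinct residues. -/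
def affineSign {N : ℕ} (n : ℕ) (x z : Fin N → ℕ) : ℤ :=
  if ∑ i, z i = ∑ i, x i then
    Matrix.detRowAlternating fun i j => if z i ≡ x j [MOD n] then (1 : ℤ) else 0
  else 0

theorem affineSign_comp_perm {N n : ℕ} (x z : Fin N → ℕ) (s : Equiv.Perm (Fin N)) :
    affineSign n x (z ∘ s) = Equiv.Perm.sign s • affineSign n x z := by
  have h1 : ∑ i, (z ∘ s) i = ∑ i, z i := Equiv.sum_comp s z
  rw [affineSign, affineSign, h1]
  split_ifs
  · exact AlternatingMap.map_perm Matrix.detRowAlternating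
      (fun i j => if z i ≡ x j [MOD n] then (1 : ℤ) else 0) s
  · rw [smul_zero]

theorem affineSign_congr {N n : ℕ} (x : Fin N → ℕ) {z z' : Fin N → ℕ}
    (hsum : ∑ i, z i = ∑ i, z' i) (h : ∀ i, z i ≡ z' i [MOD n]) :
    affineSign n x z = affineSign n x z' := by
  have h2 : ∀ i j, z i ≡ x j [MOD n] ↔ z' i ≡ x j [MOD n] := fun i j =>
    ⟨fun h' => (h i).symm.trans h', fun h' => (h i).trans h'⟩
  simp only [affineSign, hsum, h2]

/-- Distinct points of the fundamental alcove lie in distinct orbits. -/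
theorem affineSign_eq {N n : ℕ} {x y : Fin N → ℕ} (hx : StrictAnti x) (hy : StrictAnti y)
    (hxn : ∀ i j, x i < x j + n) (hyn : ∀ i j, y i < y j + n) :
    affineSign n x y = if y = x then 1 else 0 := by
  have key : ∀ s : Equiv.Perm (Fin N), ∑ i, y i = ∑ i, x i → (∀ i, y (s i) ≡ x i [MOD n]) →
      y = x := by
    intro s hsum hs
    have hk : ∀ i, ∃ k : ℤ, (y (s i) : ℤ) = x i + n * k := fun i => by
      obtain ⟨k, hk⟩ := Nat.modEq_iff_dvd.1 (hs i).symm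
      exact ⟨k, by omega⟩
    choose k hk using hk
    have hn : ∀ i : Fin N, 0 < n := fun i => by have := hxn i i; omega
    have hksum : ∑ i, k i = 0 := by
      rcases isEmpty_or_nonempty (Fin N) with hemp | ⟨⟨i0⟩⟩
      · simp
      have h1 : ∑ i, (y (s i) : ℤ) = ∑ i, (x i : ℤ) := by
        rw [Equiv.sum_comp s fun i => (y i : ℤ)]
        exact_mod_cast hsum
      simp only [hk, Finset.sum_add_distrib, ← Finset.mul_sum] at h1
      have := hn i0
      have h2 : (n : ℤ) * ∑ i, k i = 0 := by linarith
      rcases mul_eq_zero.1 h2 with h3 | h3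
      · omega
      · exact h3
    -- A nonzero translation k of zero sum has k_a ≥ 1 and k_b ≤ -1; then y_{s a} - y_{s b} ≥ x_a -
    -- x_b + 2n > n, against the alcove bound for y.
    have hk0 : ∀ i, k i = 0 := by
      by_contra! hne
      obtain ⟨i, hi⟩ := hne
      obtain ⟨a, -, ha⟩ := Finset.exists_pos_of_sum_zero_of_exists_nonzero k hksum
        ⟨i, Finset.mem_univ i, hi⟩
      obtain ⟨b, -, hb⟩ := Finset.exists_pos_of_sum_zero_of_exists_nonzero (fun i => -k i)
        (by rw [Finset.sum_neg_distrib, hksum, neg_zero]) ⟨i, Finset.mem_univ i, neg_ne_zero.2 hi⟩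
      have h1 := hyn (s a) (s b)
      have h2 := hxn b a
      have h3 := hk a
      have h4 := hk b
      have h5 : (n : ℤ) * 1 ≤ n * k a := by gcongr; omega
      have h6 : (n : ℤ) * 1 ≤ n * -k b := by gcongr; omega
      rw [mul_neg] at h6
      omega
    have hys : y ∘ s = x := by
      ext i
      have := hk i
      rw [hk0, mul_zero, add_zero] at this
      exact_mod_cast this
    -- As x and y are both strictly decreasing, s preserves order and hence is the identity.
    have hmono : StrictMono s := fun i j hij => by
      have h1 := hx hij
      rw [← hys] at h1
      exact hy.lt_iff_gt.1 h1
    have hs1 : (s : Fin N → Fin N) = id := by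
      have := Subsingleton.elim (hmono.orderIsoOfSurjective _ s.surjective) (OrderIso.refl _)
      ext i
      exact congrArg Fin.val (DFunLike.congr_fun this i)
    rw [← hys, hs1, Function.comp_id]
  split_ifs with hyx
  · subst hyx
    rw [affineSign, if_pos rfl]
    have : (fun i j => if y i ≡ y j [MOD n] then (1 : ℤ) else 0) =
        (1 : Matrix (Fin N) (Fin N) ℤ) := by
      ext i j
      rw [Matrix.one_apply]
      refine if_congr ⟨fun h => ?_, fun h => h ▸ Nat.ModEq.refl _⟩ rfl rfl
      refine hy.injective ?_
      obtain ⟨k, hk⟩ := Nat.modEq_iff_dvd.1 h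
      have h1 := hyn i j
      have h2 := hyn j i
      have h3 : k < 1 := by
        by_contra hk1
        have : (n : ℤ) * 1 ≤ n * k := by gcongr; omega
        omega
      have h4 : -k < 1 := by
        by_contra hk1
        have : (n : ℤ) * 1 ≤ n * -k := by gcongr; omega
        rw [mul_neg] at this
        omega
      have h5 : k = 0 := by omega
      rw [h5, mul_zero] at hk
      omega
    rw [this]
    exact Matrix.det_one
  · rw [affineSign]
    split_ifs with hsum
    · refine (Matrix.det_apply _).trans (Finset.sum_eq_zero fun s _ => ?_)
      obtain ⟨i, hi⟩ : ∃ i, ¬ y (s i) ≡ x i [MOD n] := by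
        by_contra! h
        exact hyx (key s hsum h)
      rw [Finset.prod_eq_zero (Finset.mem_univ i) (if_neg hi), smul_zero]
    · rfl

/-- The linear extension of `affineSign` to polynomials. -/
noncomputable def affineFunctional {N : ℕ} (n : ℕ) (x : Fin N → ℕ) :
    MvPolynomial (Fin N) ℤ →ₗ[ℤ] ℤ :=
  (basisMonomials (Fin N) ℤ).constr ℤ fun b => affineSign n x b

theorem affineFunctional_monomial {N n : ℕ} (x : Fin N → ℕ) (b : Fin N →₀ ℕ) (a : ℤ) :
    affineFunctional n x (monomial b a) = a * affineSign n x b := by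
  have h : monomial b a = a • basisMonomials (Fin N) ℤ b := by
    rw [coe_basisMonomials, smul_monomial, smul_eq_mul, mul_one]
  rw [h, map_smul, affineFunctional, Module.Basis.constr_basis, smul_eq_mul]

theorem affineFunctional_rename {N n : ℕ} (x : Fin N → ℕ) (s : Equiv.Perm (Fin N))
    (p : MvPolynomial (Fin N) ℤ) :
    affineFunctional n x (rename s p) = (Equiv.Perm.sign s : ℤ) * affineFunctional n x p := by
  induction p using MvPolynomial.induction_on' with
  | monomial u a =>
    have h : (Finsupp.mapDomain s u : Fin N → ℕ) = u ∘ (s⁻¹ : Equiv.Perm (Fin N)) := by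
      rw [← Finsupp.equivMapDomain_eq_mapDomain]
      rfl
    rw [rename_monomial, affineFunctional_monomial, affineFunctional_monomial, h,
      affineSign_comp_perm, Equiv.Perm.sign_inv, Units.smul_def, smul_eq_mul]
    ring
  | add p r hp hr => rw [map_add, map_add, map_add, hp, hr, mul_add]

/-- The sign in each of the N! terms of the alternant cancels the sign from renaming, f being
symmetric. -/
theorem affineFunctional_mul_alternant {N n : ℕ} (x z : Fin N → ℕ) {f : MvPolynomial (Fin N) ℤ}
    (hf : f.IsSymmetric) :
    affineFunctional n x (f * alternant N z) =
      N.factorial * affineFunctional n x (f * ∏ i, X i ^ z i) := by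
  rw [alternant_eq_sum, Finset.mul_sum, map_sum]
  have h : ∀ s : Equiv.Perm (Fin N), affineFunctional n x (f * (Equiv.Perm.sign s : ℤ) •
      rename s (∏ i, (X i : MvPolynomial (Fin N) ℤ) ^ z i)) =
        affineFunctional n x (f * ∏ i, X i ^ z i) := by
    intro s
    conv_lhs => rw [mul_smul_comm, ← hf s, ← map_mul, map_zsmul, affineFunctional_rename,
      smul_eq_mul, ← mul_assoc, ← Units.val_mul, Int.units_mul_self, Units.val_one, one_mul]
  rw [Finset.sum_congr rfl fun s _ => h s]
  simp [Fintype.card_perm]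

theorem prod_X_pow_eq_monomial_one {N : ℕ} (z : Fin N → ℕ) :
    (∏ i, (X i : MvPolynomial (Fin N) ℤ) ^ z i) =
      monomial (Finsupp.equivFunOnFinite.symm z) 1 := by
  rw [monomial_eq, Finsupp.prod_fintype _ _ (by simp)]
  simp

/-- Since z_i ≡ z_j, swapping i and j in f alone has the same effect modulo n as swapping them in
the whole product, namely a sign. As f is invariant, the value equals its own negative. -/
theorem affineFunctional_mul_eq_zero {N n : ℕ} (x : Fin N → ℕ) {z : Fin N → ℕ} {i j : Fin N}
    (hij : i ≠ j) (hz : z i ≡ z j [MOD n]) {f : MvPolynomial (Fin N) ℤ} (hf : f.IsSymmetric) :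
    affineFunctional n x (f * ∏ i, X i ^ z i) = 0 := by
  have h : ∀ p : MvPolynomial (Fin N) ℤ, affineFunctional n x (rename (Equiv.swap i j) p *
      ∏ i, X i ^ z i) = -affineFunctional n x (p * ∏ i, X i ^ z i) := by
    intro p
    induction p using MvPolynomial.induction_on' with
    | monomial u a =>
      have h : (Finsupp.mapDomain (Equiv.swap i j) u : Fin N → ℕ) = u ∘ Equiv.swap i j := by
        rw [← Finsupp.equivMapDomain_eq_mapDomain]
        rfl
      rw [rename_monomial, prod_X_pow_eq_monomial_one, monomial_mul, monomial_mul, mul_one,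
        affineFunctional_monomial,
        affineFunctional_monomial, ← mul_neg]
      congr 1
      have h2 := affineSign_comp_perm (n := n) x (u + z) (Equiv.swap i j)
      rw [Equiv.Perm.sign_swap hij, Units.neg_smul, one_smul] at h2
      rw [Finsupp.coe_add, Finsupp.coe_add, h]
      refine Eq.trans (affineSign_congr x ?_ fun l => ?_) h2
      · simp only [Pi.add_apply, Function.comp_apply, Finset.sum_add_distrib]
        congr 1
        exact (Equiv.sum_comp (Equiv.swap i j) z).symm
      · refine Nat.ModEq.add_left _ ?_
        change z l ≡ z (Equiv.swap i j l) [MOD n]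
        rcases eq_or_ne l i with rfl | hli
        · simpa using hz
        rcases eq_or_ne l j with rfl | hlj
        · simpa using hz.symm
        · rw [Equiv.swap_apply_of_ne_of_ne hli hlj]
    | add p r hp hr => rw [map_add, add_mul, add_mul, map_add, map_add, hp, hr, neg_add]
  have := h f
  rw [hf] at this
  linarith

/-- The coordinate functionals on symmetric polynomials. -/
noncomputable def fusionFunctional {N : ℕ} (n : ℕ) (x : Fin N → ℕ) : SymPoly N →ₗ[ℤ] ℤ :=
  affineFunctional n x ∘ₗ LinearMap.mulRight ℤ (∏ i, X i ^ staircase N i) ∘ₗ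
    (symmetricSubalgebra (Fin N) ℤ).val.toLinearMap

/-- By the bialternant formula two evaluations of the functional on f times the alternant of z
agree; cancel N! in ℤ. -/
theorem fusionFunctional_mul_jacobiTrudi {N n : ℕ} (x z : Fin N → ℕ) (f : SymPoly N) :
    fusionFunctional n x (f * jacobiTrudi N z) =
      affineFunctional n x ((f : MvPolynomial (Fin N) ℤ) * ∏ i, X i ^ z i) := by
  have h1 := affineFunctional_mul_alternant (n := n) x (staircase N) (f * jacobiTrudi N z).2
  have h2 := affineFunctional_mul_alternant (n := n) x z f.2
  rw [MulMemClass.coe_mul, mul_assoc, jacobiTrudi_mul_alternant, h2] at h1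
  exact (mul_left_cancel₀ (by exact_mod_cast N.factorial_ne_zero) h1).symm

theorem fusionFunctional_jacobiTrudi {N n : ℕ} (x z : Fin N → ℕ) :
    fusionFunctional n x (jacobiTrudi N z) = affineSign n x z := by
  have h := fusionFunctional_mul_jacobiTrudi (n := n) x z 1
  rw [one_mul] at h
  rw [h, OneMemClass.coe_one, one_mul]
  rw [prod_X_pow_eq_monomial_one, affineFunctional_monomial, one_mul]
  rfl

/-- For a generator of length at most N, the first and last shifted parts differ by exactly N + L,
so they are congruent and `affineFunctional_mul_eq_zero` applies. -/
theorem fusionFunctional_eq_zero {N L : ℕ} (hN : 0 < N) (x : Fin N → ℕ) {f : SymPoly N}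
    (hf : f ∈ fusionIdeal N L) : fusionFunctional (N + L) x f = 0 := by
  -- The arbitrary multiplier g makes the claim stable under the ideal operations.
  suffices h : ∀ g : SymPoly N, fusionFunctional (N + L) x (g * f) = 0 by simpa using h 1
  induction hf using Submodule.span_induction with
  | mem f hf =>
    intro g
    obtain ⟨la, hla, rfl⟩ := hf
    by_cases hcol : la.colLen 0 ≤ N
    · rw [schurPoly_eq_jacobiTrudi hcol, fusionFunctional_mul_jacobiTrudi]
      refine affineFunctional_mul_eq_zero x (i := ⟨0, hN⟩) (j := ⟨N - 1, by omega⟩) ?_ ?_ g.2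
      -- The two indices coincide only for N = 1, where `hla` would read λ_1 = λ_1 + L + 1.
      · intro h
        have h := congrArg Fin.val h
        simp only at h
        rw [← h] at hla
        omega
      · have : shiftedParts N la ⟨0, hN⟩ = shiftedParts N la ⟨N - 1, by omega⟩ + (N + L) := by
          simp only [shiftedParts]
          omega
        rw [this]
        simp [Nat.ModEq]
    · rw [schurPoly, if_neg hcol, mul_zero, map_zero]
  | zero => simp
  | add p r _ _ hp hr => intro g; rw [mul_add, map_add, hp, hr, add_zero]
  | smul a p _ hp => intro g; rw [smul_eq_mul, ← mul_assoc]; exact hp _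

/-! ### The Schur basis of the fusion ring -/

/-- The projection from symmetric polynomials to the fusion ring. -/
noncomputable def fusionMk (N L : ℕ) : SymPoly N →+* FusionRing N L :=
  Ideal.Quotient.mk (fusionIdeal N L)

theorem fusionMk_eq_zero_iff {N L : ℕ} {f : SymPoly N} :
    fusionMk N L f = 0 ↔ f ∈ fusionIdeal N L :=
  Ideal.Quotient.eq_zero_iff_mem

theorem vanishesAtLevel_fusionMk (N L : ℕ) :
    VanishesAtLevel (Q := FusionRing N L) (fusionMk N L) L := fun la hla =>
  fusionMk_eq_zero_iff.2 (Ideal.subset_span ⟨la, hla, rfl⟩)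

theorem linearIndependent_fusionSchur {N L : ℕ} (hN : 0 < N) :
    LinearIndependent ℤ fun la : NLPartition N L => fusionSchur N L la.1 := by
  rw [linearIndependent_iff']
  intro s g hg la hla
  have h1 : ∑ mu ∈ s, g mu • schurPoly N mu.1 ∈ fusionIdeal N L := by
    rw [← fusionMk_eq_zero_iff, map_sum, ← hg]
    exact Finset.sum_congr rfl fun mu _ => map_zsmul (fusionMk N L) _ _
  have h2 := fusionFunctional_eq_zero hN (shiftedParts N la.1) h1
  rw [map_sum, Finset.sum_eq_single la _ (fun h => absurd hla h)] at h2
  all_goals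
    have hpart := fun mu : NLPartition N L => (isNLPartition_iff hN).1 mu.2
  · rw [map_zsmul, schurPoly_eq_jacobiTrudi la.2.1, fusionFunctional_jacobiTrudi,
      affineSign_eq (shiftedParts_strictAnti _ _) (shiftedParts_strictAnti _ _) (hpart la).2
        (hpart la).2, if_pos rfl] at h2
    simpa using h2
  · intro mu _ hne
    rw [map_zsmul, schurPoly_eq_jacobiTrudi mu.2.1, fusionFunctional_jacobiTrudi,
      affineSign_eq (shiftedParts_strictAnti _ _) (shiftedParts_strictAnti _ _) (hpart la).2
        (hpart mu).2, if_neg, smul_zero]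
    exact fun h => hne (Subtype.ext (eq_of_shiftedParts_eq mu.2.1 la.2.1 h))

theorem span_fusionSchur {N L : ℕ} (hN : 0 < N) :
    ⊤ ≤ Submodule.span ℤ (Set.range fun la : NLPartition N L => fusionSchur N L la.1) := by
  rintro f -
  obtain ⟨f, rfl⟩ : ∃ g, fusionMk N L g = f := Ideal.Quotient.mk_surjective f
  have hf : f ∈ Submodule.span ℤ (Set.range (jacobiTrudi N)) :=
    span_range_jacobiTrudi N ▸ Submodule.mem_top
  induction hf using Submodule.span_induction with
  | mem f hf =>
    obtain ⟨z, rfl⟩ := hf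
    rw [map_jacobiTrudi (Q := FusionRing N L)]
    refine (vanishesAtLevel_fusionMk N L).fusionDet_mem (fun z hz hzn => ?_) z
    obtain ⟨la, hla, rfl⟩ := exists_shiftedParts_eq hz
    rw [← map_schurPoly (Q := FusionRing N L) _ hla]
    exact Submodule.subset_span ⟨⟨la, (isNLPartition_iff hN).2 ⟨hla, hzn⟩⟩, rfl⟩
  | zero => rw [map_zero]; exact Submodule.zero_mem _
  | add p r _ _ hp hr => rw [map_add]; exact Submodule.add_mem _ hp hr
  | smul a p _ hp => rw [map_zsmul]; exact Submodule.smul_mem _ a hp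

/-- The Schur basis of the fusion ring. -/
noncomputable def fusionBasis {N : ℕ} (L : ℕ) (hN : 0 < N) :
    Module.Basis (NLPartition N L) ℤ (FusionRing N L) :=
  Module.Basis.mk (linearIndependent_fusionSchur hN) (span_fusionSchur hN)

theorem fusionBasis_apply {N L : ℕ} (hN : 0 < N) (la : NLPartition N L) :
    fusionBasis L hN la = fusionSchur N L la.1 :=
  Module.Basis.mk_apply _ _ _

/-! ### Cyclic neighbours, horizontal strips and tableaux -/

/-- The cyclic predecessor on `Fin N`. -/
theorem exists_perm_cyclic_pred (N : ℕ) : ∃ r : Equiv.Perm (Fin N),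
    ∀ i, (r i : ℕ) = if (i : ℕ) = 0 then N - 1 else i - 1 := by
  refine ⟨⟨fun i => ⟨if (i : ℕ) = 0 then N - 1 else i - 1, by split_ifs <;> omega⟩,
    fun i => ⟨if (i : ℕ) = N - 1 then 0 else i + 1, by split_ifs <;> omega⟩, fun i => ?_,
    fun i => ?_⟩, fun i => rfl⟩
  · ext
    have := i.2
    dsimp only
    split_ifs <;> omega
  · ext
    have := i.2
    by_cases h : (i : ℕ) = N - 1 <;> simp [h]

/-- Stepping down from any element reaches 0, then wraps to N - 1 and descends through everything.
This is the transitivity required by the cancellation argument. -/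
theorem eq_univ_of_cyclic_pred_mem {N : ℕ} {r : Fin N → Fin N}
    (hr : ∀ i, (r i : ℕ) = if (i : ℕ) = 0 then N - 1 else i - 1) {T : Finset (Fin N)}
    (hT : T.Nonempty) (h : ∀ i ∈ T, r i ∈ T) : T = Finset.univ := by
  have down : ∀ d : ℕ, ∀ i ∈ T, ∀ j : Fin N, (i : ℕ) = j + d → j ∈ T := by
    intro d
    induction d with
    | zero => intro i hi j hij; rwa [← Fin.ext hij]
    | succ d ih =>
      intro i hi j hij
      refine ih (r i) (h i hi) j ?_
      rw [hr, if_neg (by omega)]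
      omega
  obtain ⟨i, hi⟩ := hT
  have h0 : (⟨0, i.pos⟩ : Fin N) ∈ T := down i i hi _ (by simp)
  have h1 := h _ h0
  have h2 := hr ⟨0, i.pos⟩
  rw [if_pos rfl] at h2
  refine Finset.eq_univ_iff_forall.2 fun j => down (N - 1 - j) _ h1 j ?_
  omega

theorem IsNLHorizontalStrip.isNLPartition_right {N L : ℕ} {la mu : YoungDiagram}
    (h : IsNLHorizontalStrip N L la mu) : IsNLPartition N L mu := by
  obtain ⟨hs, hcol, hrow⟩ := h
  refine ⟨?_, (hs 0).1.trans hrow⟩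
  rw [YoungDiagram.colLen_zero_le_iff] at hcol ⊢
  have := (hs N).1
  omega

/-- The elements acting on Schur basis elements by adding horizontal strips. -/
noncomputable def fusionStrip {Q : Type*} [CommRing Q] {N : ℕ} (q : SymPoly N →+* Q) (L k : ℕ) :
    Q :=
  if k ≤ L then fusionHomogeneous q k else 0

/-- Horizontal strips in terms of the differences of the parts. -/
theorem isNLHorizontalStrip_iff {N L k : ℕ} (hN : 0 < N) {la mu : YoungDiagram}
    (hla : la.colLen 0 ≤ N) (hmu : mu.colLen 0 ≤ N) {r : Fin N → Fin N}
    (hr : ∀ i, (r i : ℕ) = if (i : ℕ) = 0 then N - 1 else i - 1) :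
    (IsNLHorizontalStrip N L la mu ∧ la.card = mu.card + k) ↔
      ∃ b : Fin N → ℕ, (∑ i, b i = k ∧ ∀ i, shiftedParts N mu i + b i <
        shiftedParts N mu (r i) + if (i : ℕ) = 0 then N + L else 0) ∧
        shiftedParts N mu + b = shiftedParts N la := by
  rw [YoungDiagram.card_eq_sum_rowLen hla, YoungDiagram.card_eq_sum_rowLen hmu]
  constructor
  · rintro ⟨⟨hs, -, hrow⟩, hcard⟩
    refine ⟨fun i => la.rowLen i - mu.rowLen i, ⟨?_, fun i => ?_⟩, ?_⟩
    · have := Finset.sum_tsub_distrib Finset.univ (f := fun i : Fin N => la.rowLen i)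
        (g := fun i : Fin N => mu.rowLen i) fun i _ => (hs i).1
      dsimp only
      omega
    · have h1 := (hs i).1
      have h2 := i.2
      simp only [shiftedParts, hr]
      split_ifs with h
      · rw [h] at h1 ⊢
        omega
      · have h3 := (hs (i - 1)).2
        rw [Nat.sub_add_cancel (by omega)] at h3
        omega
    · ext i
      have h1 := (hs i).1
      simp only [shiftedParts, Pi.add_apply]
      omega
  · rintro ⟨b, ⟨hb, hbound⟩, heq⟩
    have hrow : ∀ i : Fin N, la.rowLen i = mu.rowLen i + b i := by
      intro i
      have := congrFun heq i
      simp only [shiftedParts, Pi.add_apply] at this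
      omega
    simp only [shiftedParts, hr] at hbound
    refine ⟨⟨fun i => ⟨?_, ?_⟩, hla, ?_⟩, ?_⟩
    · by_cases hi : i < N
      · have := hrow ⟨i, hi⟩
        simp only at this
        omega
      · rw [YoungDiagram.rowLen_eq_zero_of_le hmu (not_lt.1 hi)]
        exact Nat.zero_le _
    · by_cases hi : i + 1 < N
      · have h1 := hrow ⟨i + 1, hi⟩
        have h2 := hbound ⟨i + 1, hi⟩
        simp only [Nat.add_eq_zero_iff, one_ne_zero, and_false, if_false,
          Nat.add_sub_cancel] at h1 h2
        omega
      · rw [YoungDiagram.rowLen_eq_zero_of_le hla (not_lt.1 hi)]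
        exact Nat.zero_le _
    · have h1 := hrow ⟨0, hN⟩
      have h2 := hbound ⟨0, hN⟩
      simp only [if_true] at h1 h2
      omega
    · simp only [hrow, Finset.sum_add_distrib, hb]

theorem repr_mul_eq_sum {ι R : Type*} [CommRing R] (S : Module.Basis ι ℤ R) (x w : R) (i : ι) :
    S.repr (x * w) i = ∑ j ∈ (S.repr w).support, S.repr w j * S.repr (x * S j) i := by
  conv_lhs => rw [← S.linearCombination_repr w, Finsupp.linearCombination_apply, Finsupp.sum,
    Finset.mul_sum, map_sum, Finsupp.finsetSum_apply]
  refine Finset.sum_congr rfl fun j _ => ?_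
  rw [mul_smul_comm, map_smul, Finsupp.smul_apply, smul_eq_mul]

theorem schurPoly_bot (N : ℕ) : schurPoly N ⊥ = 1 := by
  have : shiftedParts N ⊥ = staircase N := by
    ext i
    rw [shiftedParts, YoungDiagram.rowLen_bot, zero_add, staircase]
  rw [schurPoly_eq_jacobiTrudi, this, jacobiTrudi_staircase]
  rw [YoungDiagram.colLen_zero_le_iff, YoungDiagram.rowLen_bot]

theorem isNLPartition_bot (N L : ℕ) : IsNLPartition N L ⊥ := by
  refine ⟨?_, ?_⟩
  · rw [YoungDiagram.colLen_zero_le_iff, YoungDiagram.rowLen_bot]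
  · simp [YoungDiagram.rowLen_bot]

theorem Kcyl_zero {N L : ℕ} {la mu : YoungDiagram} [Decidable (mu = la)] (a : Fin 0 → ℕ) :
    Kcyl N L la mu a = if mu = la then 1 else 0 := by
  split_ifs with h
  · subst h
    rw [Kcyl, Set.ncard_eq_one]
    refine ⟨fun _ => mu, Set.eq_singleton_iff_unique_mem.2
      ⟨⟨rfl, rfl, fun i => i.elim0⟩, fun nu hnu => ?_⟩⟩
    ext1 i
    rw [Fin.eq_zero i]
    exact hnu.1
  · rw [Kcyl, Set.ncard_eq_zero (cylTableaux_finite N L la mu a)]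
    exact Set.eq_empty_of_forall_notMem fun nu hnu => h (hnu.1.symm.trans hnu.2.1)

/-- Cylindric tableaux with given last step. -/
theorem mem_cylTableaux_succ {N L r : ℕ} {la mu : YoungDiagram} {a : Fin (r + 1) → ℕ}
    {nu : Fin (r + 1 + 1) → YoungDiagram} :
    nu ∈ cylTableaux N L la mu a ↔
      (fun i => nu i.castSucc) ∈ cylTableaux N L (nu (Fin.last r).castSucc) mu
        (fun i => a i.castSucc) ∧ nu (Fin.last (r + 1)) = la ∧
      (IsNLHorizontalStrip N L la (nu (Fin.last r).castSucc) ∧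
        la.card = (nu (Fin.last r).castSucc).card + a (Fin.last r)) := by
  simp only [cylTableaux, Set.mem_ofPred_eq, Fin.forall_fin_succ', Fin.succ_last, true_and,
    Fin.castSucc_zero, Fin.succ_castSucc]
  constructor
  · rintro ⟨h0, rfl, h1, h2⟩
    exact ⟨⟨h0, h1⟩, rfl, h2⟩
  · rintro ⟨⟨h0, h1⟩, rfl, h2⟩
    exact ⟨h0, rfl, h1, h2⟩

-- Tableaux are sorted by their next-to-last shape, which the last strip forces to be an
-- (N,L)-partition. The set t keeps the sum finite; any t containing all contributing shapes serves.
open Classical in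
theorem Kcyl_succ {N L r : ℕ} {la mu : YoungDiagram} (a : Fin (r + 1) → ℕ)
    (t : Finset (NLPartition N L))
    (ht : ∀ nu : NLPartition N L, Kcyl N L nu.1 mu (fun i => a (Fin.castSucc i)) ≠ 0 → nu ∈ t) :
    Kcyl N L la mu a = ∑ nu ∈ t, Kcyl N L nu.1 mu (fun i => a (Fin.castSucc i)) *
      if IsNLHorizontalStrip N L la nu.1 ∧ la.card = nu.1.card + a (Fin.last r) then 1 else 0 := by
  have hfin := cylTableaux_finite N L la mu a
  have hmaps : ∀ nu ∈ hfin.toFinset, nu (Fin.last r).castSucc ∈ t.image Subtype.val := by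
    intro nu hnu
    rw [Set.Finite.mem_toFinset, mem_cylTableaux_succ] at hnu
    obtain ⟨h1, -, h2, -⟩ := hnu
    refine Finset.mem_image.2 ⟨⟨_, h2.isNLPartition_right⟩, ht _ ?_, rfl⟩
    exact ((Set.ncard_pos (cylTableaux_finite _ _ _ _ _)).2 ⟨_, h1⟩).ne'
  rw [Kcyl, Set.ncard_eq_toFinset_card _ hfin, Finset.card_eq_sum_card_fiberwise hmaps,
    Finset.sum_image Subtype.val_injective.injOn]
  refine Finset.sum_congr rfl fun nu _ => ?_
  rw [mul_boole]
  split_ifs with h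
  · rw [Kcyl, Set.ncard_eq_toFinset_card _ (cylTableaux_finite _ _ _ _ _)]
    refine Finset.card_bij' (fun n _ => fun i => n i.castSucc)
      (fun n _ => Fin.snoc (α := fun _ => YoungDiagram) n la) ?_ ?_ ?_ ?_
    · intro n hn
      rw [Finset.mem_filter, Set.Finite.mem_toFinset, mem_cylTableaux_succ] at hn
      rw [Set.Finite.mem_toFinset, ← hn.2]
      exact hn.1.1
    · intro n hn
      rw [Set.Finite.mem_toFinset] at hn
      have hlast : n (Fin.last r) = nu.1 := hn.2.1
      rw [Finset.mem_filter, Set.Finite.mem_toFinset, mem_cylTableaux_succ]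
      simp only [Fin.snoc_castSucc, Fin.snoc_last, hlast]
      exact ⟨⟨hn, trivial, h⟩, trivial⟩
    · intro n hn
      rw [Finset.mem_filter, Set.Finite.mem_toFinset, mem_cylTableaux_succ] at hn
      ext1 i
      refine Fin.lastCases ?_ (fun i => ?_) i
      · rw [Fin.snoc_last, hn.1.2.1]
      · rw [Fin.snoc_castSucc]
    · intro n hn
      ext1 i
      exact Fin.snoc_castSucc (α := fun _ => YoungDiagram) _ _ _
  · rw [Finset.card_eq_zero, Finset.filter_eq_empty_iff]
    intro n hn hnu
    rw [Set.Finite.mem_toFinset, mem_cylTableaux_succ, hnu] at hn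
    exact h hn.2.2

/-! ### The Pieri rule and the final identity -/

section Pieri

variable {Q : Type*} [CommRing Q] {N L : ℕ} {q : SymPoly N →+* Q}
  {S : Module.Basis (NLPartition N L) ℤ Q}

open Classical in
/-- The Pieri rule in the fusion ring. -/
theorem repr_fusionStrip_mul (hN : 0 < N) (hq : VanishesAtLevel q L)
    (hS : ∀ la, S la = q (schurPoly N la.1)) (k : ℕ) (la mu : NLPartition N L) :
    S.repr (fusionStrip q L k * S mu) la =
      if IsNLHorizontalStrip N L la.1 mu.1 ∧ la.1.card = mu.1.card + k then 1 else 0 := by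
  obtain ⟨r, hr⟩ := exists_perm_cyclic_pred N
  rw [if_congr (isNLHorizontalStrip_iff hN la.2.1 mu.2.1 hr) rfl rfl]
  set x := shiftedParts N mu.1 with hx
  have hxa : StrictAnti x := shiftedParts_strictAnti N mu.1
  have hxn := ((isNLPartition_iff hN).1 mu.2).2
  rw [← hx] at hxn
  -- The affine neighbour of the first part is the last part raised by the period N + L; every other
  -- part is bounded by its predecessor.
  let e : Fin N → ℕ := fun i => if (i : ℕ) = 0 then N + L else 0
  have hle : ∀ i, x i < x (r i) + e i := by
    intro i
    simp only [e]
    split_ifs with h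
    · exact hxn _ _
    · refine hxa (Fin.lt_def.2 ?_)
      rw [hr, if_neg h]
      omega
  let g : Fin N → ℕ := fun i => x (r i) + e i - x i
  have hg : ∀ i, x i + g i = x (r i) + e i := fun i => Nat.add_sub_cancel' (hle i).le
  -- The gaps go once around the cycle, so their sum is the period, which exceeds every k ≤ L.
  have hgsum : ∑ i, g i = N + L := by
    have h1 : ∑ i, (x i + g i) = ∑ i, (x (r i) + e i) := Finset.sum_congr rfl fun i _ => hg i
    rw [Finset.sum_add_distrib, Finset.sum_add_distrib, Equiv.sum_comp r x,
      Finset.sum_eq_single (⟨0, hN⟩ : Fin N) (f := e)] at h1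
    · simpa [e] using h1
    · exact fun i _ hi => if_neg fun h => hi (Fin.ext h)
    · simp
  have hgood : ∀ b : Fin N → ℕ, (∀ i, ¬ g i ≤ b i) ↔ ∀ i, x i + b i < x (r i) + e i :=
    fun b => forall_congr' fun i => by have := hg i; omega
  by_cases hk : k ≤ L
  -- A b that stays below every gap leaves x + b in the alcove, so the determinant is itself a basis
  -- element.
  · have hrepr : ∀ b : Fin N → ℕ, (∀ i, ¬ g i ≤ b i) →
        S.repr (fusionDet q (x + b)) la =
          if x + b = shiftedParts N la.1 then 1 else 0 := by
      intro b hb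
      rw [hgood] at hb
      have hanti : StrictAnti (x + b) := by
        intro i j hij
        have h1 := hb j
        have h2 : (i : ℕ) < j := hij
        have h3 : x (r j) ≤ x i := by
          refine hxa.antitone (Fin.le_def.2 ?_)
          rw [hr, if_neg (by omega)]
          omega
        simp only [e, if_neg (show ¬(j : ℕ) = 0 by omega)] at h1
        simp only [Pi.add_apply]
        omega
      obtain ⟨nu, hnu, hnux⟩ := exists_shiftedParts_eq hanti
      have hnuNL : IsNLPartition N L nu := by
        refine (isNLPartition_iff hN).2 ⟨hnu, fun i j => ?_⟩
        rw [hnux]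
        have h1 := hb ⟨0, hN⟩
        have h2 : (x + b) i ≤ (x + b) ⟨0, hN⟩ := hanti.antitone (Fin.le_def.2 (Nat.zero_le _))
        have h3 : x (r ⟨0, hN⟩) ≤ x j := by
          refine hxa.antitone (Fin.le_def.2 ?_)
          rw [hr, if_pos rfl]
          omega
        simp only [e, if_true] at h1
        simp only [Pi.add_apply] at h2 ⊢
        omega
      rw [← hnux, ← map_schurPoly _ hnu,
        ← hS ⟨nu, hnuNL⟩, Module.Basis.repr_self, Finsupp.single_apply]
      refine if_congr ⟨fun h => ?_, fun h => ?_⟩ rfl rfl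
      · rw [← h]
      · exact Subtype.ext (eq_of_shiftedParts_eq hnu la.2.1 h)
    have hmul : fusionStrip q L k * S mu =
        ∑ b ∈ Finset.piAntidiag Finset.univ k with ∀ i, ¬ g i ≤ b i,
          fusionDet q (x + b) := by
      rw [fusionStrip, if_pos hk, hS, map_schurPoly _ mu.2.1]
      exact hq.fusionHomogeneous_mul_fusionDet x g r
        (fun T hT h => eq_univ_of_cyclic_pred_mem hr hT h)
        (fun i => ⟨e i, by simp only [e]; split_ifs <;> simp, hg i⟩) (by omega)
    rw [hmul, map_sum, Finsupp.finsetSum_apply,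
      Finset.sum_congr rfl fun b hb => hrepr b (Finset.mem_filter.1 hb).2]
    have hmem : ∀ b : Fin N → ℕ, b ∈ (Finset.piAntidiag Finset.univ k).filter
        (fun b => ∀ i, ¬ g i ≤ b i) ↔ ∑ i, b i = k ∧ ∀ i, x i + b i < x (r i) + e i := by
      intro b
      rw [Finset.mem_filter, hgood]
      simp
    split_ifs with h
    · obtain ⟨b, hb, hbx⟩ := h
      rw [Finset.sum_eq_single b, if_pos hbx]
      · exact fun b' _ hne => if_neg fun h => hne (add_left_cancel (h.trans hbx.symm))
      · exact fun h => absurd ((hmem b).2 hb) h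
    · exact Finset.sum_eq_zero fun b hb => if_neg fun hbx => h ⟨b, (hmem b).1 hb, hbx⟩
  -- Each b_i + 1 is at most g_i, so k + N ≤ N + L: strips have size at most L.
  · rw [fusionStrip, if_neg hk, zero_mul, map_zero, Finsupp.zero_apply, if_neg]
    rintro ⟨b, ⟨hbk, hb⟩, -⟩
    have h1 : ∑ i, (b i + 1) ≤ ∑ i, g i := Finset.sum_le_sum fun i _ => by
      have := (hgood b).2 hb i
      omega
    rw [Finset.sum_add_distrib, hbk, hgsum] at h1
    simp at h1
    omega

/-- Multiplication by the generators of the fusion ring counts cylindric tableaux. -/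
theorem repr_prod_fusionStrip_mul (hN : 0 < N) (hq : VanishesAtLevel q L)
    (hS : ∀ la, S la = q (schurPoly N la.1)) {r : ℕ} (a : Fin r → ℕ)
    (la mu : NLPartition N L) :
    S.repr ((∏ i, fusionStrip q L (a i)) * S mu) la =
      Kcyl N L la.1 mu.1 a := by
  classical
  induction r generalizing la with
  | zero =>
    rw [Finset.univ_eq_empty, Finset.prod_empty, one_mul, Module.Basis.repr_self,
      Finsupp.single_apply, Kcyl_zero]
    simp only [Subtype.ext_iff]
    push_cast
    rfl
  | succ r ih =>
    rw [Fin.prod_univ_castSucc, mul_right_comm, mul_comm _ (fusionStrip q L _), repr_mul_eq_sum,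
      Kcyl_succ a (S.repr ((∏ i : Fin r, fusionStrip q L (a i.castSucc)) *
        S mu)).support]
    · push_cast
      refine Finset.sum_congr rfl fun nu _ => ?_
      rw [ih (fun i => a i.castSucc) nu, repr_fusionStrip_mul hN hq hS]
    · intro nu hnu
      rw [Finsupp.mem_support_iff, ih (fun i => a i.castSucc) nu]
      exact_mod_cast hnu

/-- The numbers K_{ν,α} are the coordinates of P because S_∅ = 1, so the right side is the
coefficient of S_λ in S_μ P, computed by expanding P. Its finite support contains all nonzero terms.
-/
theorem Kcyl_eq_finsum (hN : 0 < N) (hq : VanishesAtLevel q L)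
    (hS : ∀ la, S la = q (schurPoly N la.1)) {r : ℕ} (a : Fin r → ℕ) (la mu : NLPartition N L) :
    (Function.support fun nu : NLPartition N L =>
      S.repr (S mu * S nu) la * (Kcyl N L nu.1 ⊥ a : ℤ)).Finite ∧
    (Kcyl N L la.1 mu.1 a : ℤ) =
      ∑ᶠ nu : NLPartition N L, S.repr (S mu * S nu) la * (Kcyl N L nu.1 ⊥ a : ℤ) := by
  set P : Q := ∏ i, fusionStrip q L (a i) with hP
  have hK : ∀ nu : NLPartition N L, (Kcyl N L nu.1 ⊥ a : ℤ) = S.repr P nu := by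
    intro nu
    rw [← repr_prod_fusionStrip_mul hN hq hS _ nu ⟨⊥, isNLPartition_bot N L⟩, hS, schurPoly_bot,
      map_one, mul_one]
  have hsub : (Function.support fun nu : NLPartition N L =>
      S.repr (S mu * S nu) la * (Kcyl N L nu.1 ⊥ a : ℤ)) ⊆ (S.repr P).support := by
    intro nu hnu
    rw [Finset.mem_coe, Finsupp.mem_support_iff, ← hK]
    exact right_ne_zero_of_mul hnu
  refine ⟨(Finset.finite_toSet _).subset hsub, ?_⟩
  rw [finsum_eq_sum_of_support_subset _ hsub, ← repr_prod_fusionStrip_mul hN hq hS, ← hP, mul_comm,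
    repr_mul_eq_sum]
  exact Finset.sum_congr rfl fun nu _ => by rw [hK, mul_comm]

end Pieri

theorem proposition1 (N L : ℕ) (hN : 0 < N) (hL : 0 < L) :
    ∃ S : Module.Basis (NLPartition N L) ℤ (FusionRing N L),
      (∀ rho : NLPartition N L, S rho = fusionSchur N L rho.1) ∧
      ∀ (la mu : NLPartition N L) (al : YoungDiagram),
        (Function.support fun nu : NLPartition N L =>
          S.repr (S mu * S nu) la * (Kcyl N L nu.1 ⊥ (partVector al) : ℤ)).Finite ∧
        (Kcyl N L la.1 mu.1 (partVector al) : ℤ) =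
          ∑ᶠ nu : NLPartition N L,
            S.repr (S mu * S nu) la * (Kcyl N L nu.1 ⊥ (partVector al) : ℤ) := by
  exact ⟨fusionBasis L hN, fusionBasis_apply hN, fun la mu al =>
    Kcyl_eq_finsum (Q := FusionRing N L) hN (vanishesAtLevel_fusionMk N L)
      (fusionBasis_apply hN) (partVector al) la mu⟩
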